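/- For an integer $\nu\ge 2$ let $\mathbb D=\{z\in\mathbb C:|z|<1\}$, $d\iota(z)=\frac{dz}{\pi(1-|z|^2)^2}$, $d\iota_\nu(z)=(\nu-1)(1-|z|^2)^{\nu}\,d\iota(z)$, and let $\mathcal H_\nu$ be the Hilbert space of holomorphic functions on $\mathbb D$ that are square integrable with respect to $d\iota_\nu$, with the norm of $L^2(d\iota_\nu)$ and reproducing kernel $K^\nu(x,y)=K^\nu_y(x)=(1-x\bar y)^{-\nu}$. The group $SU(1,1)$ acts unitarily on $\mathcal H_\nu$ by $(g\cdot F)(z)=(-bz+\bar a)^{-\nu}F\big(\frac{az-\bar b}{-bz+\bar a}\big)$ for $g=\begin{pmatrix}a&b\\ \bar b&\bar a\end{pmatrix}$, $|a|^2-|b|^2=1$. The covariant symbol of $A\in B(\mathcal H_\nu)$ is the function $R_\nu(A)(z)=(AK^\nu_z)(z)\,(1-|z|^2)^\nu$ on $\mathbb D$. For $f\in L^p(\mathbb D,d\iota)$, $1\le p\le\infty$, let $R_\nu^*(f)=\frac1{\nu-1}T_f\in B(\mathcal H_\nu)$, where $T_f$ is the Toeplitz operator, $\langle T_fu,v\rangle_\nu=\int_{\mathbb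 D}fu\bar v\,d\iota_\nu$ for $u,v\in\mathcal H_\nu$, and let $B_\nu(f)=R_\nu(R_\nu^*(f))$ be the Berezin transform. Write $(x)_k=x(x+1)\cdots(x+k-1)$. Let $\mu,\nu\ge2$ and $k\ge0$ be integers. Then there is an $SU(1,1)$-intertwining partial isometry $P_k$ from the Hilbert space tensor product $\mathcal H_\mu\otimes\mathcal H_\nu$ onto $\mathcal H_{\mu+\nu+2k}$ (so $P_kP_k^*=I$). For every such $P_k$, with the channel $\mathcal T^\nu_{\mu,k}(A)=P_k(A\otimes I_\nu)P_k^*$ for $A\in B(\mathcal H_\mu)$, and for every $1\le p\le\infty$ and $f\in L^p(\mathbb D,d\iota)$, one has at every point of $\mathbb D$ $$R_{\mu+\nu+2k}\,\mathcal T^\nu_{\mu,k}\,R_\mu^*(f)=C_{\mu,\nu,k}^2\sum_{j=0}^k(-1)^j\binom kj\frac{(\nu+k-j)_k}{(\nu)_k}\,B_{\mu+j}(f),\qquad C_{\mu,\nu,k}^{2}=\frac{(\mu)_k(\nu)_k}{k!\,(\mu+\nu+k-1)_k}.$$ -/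

import Mathlib

namespace SU11

open MeasureTheory Metric Complex ComplexConjugate
open scoped ENNReal NNReal TensorProduct

noncomputable section

/-- The invariant measure `dι = dz / (π (1 - |z|²)²)` on the unit disc, as a measure on `ℂ`
carried by the disc. -/
def iota : Measure ℂ :=
  (volume.restrict (ball (0 : ℂ) 1)).withDensity
    fun z => ENNReal.ofReal (1 / (Real.pi * (1 - ‖z‖ ^ 2) ^ 2))

/-- The weighted measure `dι_ν = (ν - 1) (1 - |z|²)^ν dι`; for `ν ≥ 2` a probability measure. -/
def iotaW (ν : ℕ) : Measure ℂ :=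
  iota.withDensity fun z => ENNReal.ofReal (((ν : ℝ) - 1) * (1 - ‖z‖ ^ 2) ^ ν)

lemma ae_iota_mem : ∀ᵐ z ∂iota, z ∈ ball (0 : ℂ) 1 :=
  (withDensity_absolutelyContinuous _ _).ae_le (ae_restrict_mem measurableSet_ball)

lemma iotaW_ac (ν : ℕ) : iotaW ν ≪ iota := withDensity_absolutelyContinuous _ _

lemma ae_iotaW_mem (ν : ℕ) : ∀ᵐ z ∂iotaW ν, z ∈ ball (0 : ℂ) 1 :=
  (iotaW_ac ν).ae_le ae_iota_mem

lemma measurable_weight (ν : ℕ) :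
    Measurable fun z : ℂ => ENNReal.ofReal (((ν : ℝ) - 1) * (1 - ‖z‖ ^ 2) ^ ν) := by fun_prop

lemma measurable_density :
    Measurable fun z : ℂ => ENNReal.ofReal (1 / (Real.pi * (1 - ‖z‖ ^ 2) ^ 2)) := by fun_prop

lemma iotaW_eq_zero {ν : ℕ} (hν : ¬ 2 ≤ ν) : iotaW ν = 0 := by
  have h1 : (ν : ℝ) - 1 ≤ 0 := by
    have : ν ≤ 1 := by omega
    have : (ν : ℝ) ≤ 1 := by exact_mod_cast this
    linarith
  unfold iotaW
  rw [withDensity_congr_ae (g := 0), withDensity_zero]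
  filter_upwards [ae_iota_mem] with z hz
  have hz' : ‖z‖ < 1 := by simpa using hz
  have : 0 ≤ (1 - ‖z‖ ^ 2) ^ ν := pow_nonneg (by nlinarith [norm_nonneg z]) _
  simpa using mul_nonpos_of_nonpos_of_nonneg h1 this

lemma circle_submean {F : ℂ → ℂ} {z : ℂ} {r : ℝ} (hF : DifferentiableOn ℂ F (ball z r))
    {ρ : ℝ} (h0 : 0 < ρ) (hρ : ρ < r) :
    ‖F z‖ₑ ^ 2 * ENNReal.ofReal (2 * Real.pi) ≤
      ∫⁻ θ in Set.Ioo (-Real.pi) Real.pi, ‖F (z + Complex.polarCoord.symm (ρ, θ))‖ₑ ^ 2 := by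
  have hd : DiffContOnCl ℂ (fun x => F x ^ 2) (ball z |ρ|) := by
    rw [abs_of_pos h0]
    refine DifferentiableOn.diffContOnCl ?_
    rw [closure_ball _ h0.ne']
    exact (hF.mono (closedBall_subset_ball hρ)).pow 2
  have hav := hd.circleAverage
  rw [Real.circleAverage_eq_integral_add (-Real.pi)] at hav
  have h3 : (∫ θ in (-Real.pi)..Real.pi, F (circleMap z ρ θ) ^ 2) = (2 * Real.pi : ℝ) • F z ^ 2 := by
    have e := intervalIntegral.integral_comp_add_right
      (a := 0) (b := 2 * Real.pi) (fun θ => F (circleMap z ρ θ) ^ 2) (-Real.pi)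
    rw [e] at hav
    have e1 : 0 + -Real.pi = -Real.pi := by ring
    have e2 : 2 * Real.pi + -Real.pi = Real.pi := by ring
    rw [e1, e2] at hav
    rw [← hav, smul_smul, mul_inv_cancel₀ (by positivity), one_smul]
  have h4 : ‖(2 * Real.pi : ℝ) • F z ^ 2‖ₑ = ‖F z‖ₑ ^ 2 * ENNReal.ofReal (2 * Real.pi) := by
    rw [enorm_smul, enorm_pow, mul_comm, Real.enorm_eq_ofReal (by positivity)]
  rw [← h4, ← h3, intervalIntegral.integral_of_le (by linarith [Real.pi_pos]),
    integral_Ioc_eq_integral_Ioo]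
  refine (enorm_integral_le_lintegral_enorm _).trans (le_of_eq ?_)
  refine lintegral_congr fun θ => ?_
  rw [enorm_pow, Complex.polarCoord_symm_apply, circleMap, Complex.exp_mul_I]
  simp

/-- Sub-mean value property over discs. -/
lemma submean {F : ℂ → ℂ} {z : ℂ} {r : ℝ} (hr : 0 < r) (hF : DifferentiableOn ℂ F (ball z r)) :
    ‖F z‖ₑ ^ 2 * ENNReal.ofReal (Real.pi * r ^ 2) ≤ ∫⁻ x in ball z r, ‖F x‖ₑ ^ 2 := by
  classical
  set Φ : ℂ → ℝ≥0∞ := (ball z r).piecewise (fun x => ‖F x‖ₑ ^ 2) 0 with hΦ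
  have hm : Measurable Φ :=
    ContinuousOn.measurable_piecewise ((ENNReal.continuous_pow 2).comp_continuousOn
      hF.continuousOn.enorm) continuousOn_const measurableSet_ball
  have e1 : ∫⁻ x in ball z r, ‖F x‖ₑ ^ 2 = ∫⁻ x, Φ x := by
    rw [← lintegral_indicator measurableSet_ball]
    refine lintegral_congr fun x => ?_
    simp [hΦ, Set.indicator]
  rw [e1, ← lintegral_add_left_eq_self Φ z, ← Complex.lintegral_comp_polarCoord_symm,
    polarCoord_target, Measure.volume_eq_prod, ← Measure.prod_restrict, lintegral_prod]
  · calc ‖F z‖ₑ ^ 2 * ENNReal.ofReal (Real.pi * r ^ 2)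
        = ∫⁻ ρ in Set.Ioo 0 r, ENNReal.ofReal ρ * (‖F z‖ₑ ^ 2 * ENNReal.ofReal (2 * Real.pi)) := by
          rw [lintegral_mul_const _ (by fun_prop)]
          have : ∫⁻ ρ in Set.Ioo 0 r, ENNReal.ofReal ρ = ENNReal.ofReal (r ^ 2 / 2) := by
            rw [← ofReal_integral_eq_lintegral_ofReal]
            · rw [← integral_Ioc_eq_integral_Ioo, ← intervalIntegral.integral_of_le hr.le]
              simp
            · exact (continuous_id.integrableOn_Icc (a := 0) (b := r)).mono_set Set.Ioo_subset_Icc_self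
            · filter_upwards [ae_restrict_mem measurableSet_Ioo] with x hx using hx.1.le
          rw [this, mul_left_comm, ← ENNReal.ofReal_mul (by positivity)]
          congr 2; ring
      _ ≤ ∫⁻ ρ in Set.Ioo 0 r, ∫⁻ θ in Set.Ioo (-Real.pi) Real.pi,
            ENNReal.ofReal ρ • Φ (z + Complex.polarCoord.symm (ρ, θ)) := by
          refine setLIntegral_mono' measurableSet_Ioo fun ρ hρ => ?_
          simp only [smul_eq_mul]
          rw [lintegral_const_mul' _ _ ENNReal.ofReal_ne_top]
          gcongr
          refine (circle_submean hF hρ.1 hρ.2).trans (le_of_eq ?_)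
          refine lintegral_congr fun θ => ?_
          rw [hΦ, Set.piecewise_eq_of_mem]
          rw [mem_ball, dist_eq_norm, add_sub_cancel_left, Complex.norm_polarCoord_symm,
            abs_of_pos hρ.1]
          exact hρ.2
      _ ≤ _ := lintegral_mono_set Set.Ioo_subset_Ioi_self
  · refine Measurable.aemeasurable ?_
    have : Measurable fun p : ℝ × ℝ => Complex.polarCoord.symm p := by
      simp only [Complex.polarCoord_symm_apply]
      fun_prop
    simp only [smul_eq_mul]
    exact (by fun_prop : Measurable fun p : ℝ × ℝ => ENNReal.ofReal p.1).mul
      (hm.comp (this.const_add z))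

lemma lintegral_iotaW_ge {ν : ℕ} (hν : 2 ≤ ν) (φ : ℂ → ℝ≥0∞) {z : ℂ} {s : ℝ} (hs : 0 < s)
    (hsz : ‖z‖ + 2 * s ≤ 1) :
    ENNReal.ofReal (s ^ (ν - 2) / Real.pi) * ∫⁻ x in ball z s, φ x ≤ ∫⁻ x, φ x ∂iotaW ν := by
  have hsub : ball z s ⊆ ball 0 1 := by
    intro x hx
    rw [mem_ball, dist_eq_norm] at hx
    rw [mem_ball_zero_iff]
    have := norm_add_le (x - z) z
    rw [sub_add_cancel] at this
    linarith
  unfold iotaW iota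
  rw [← withDensity_mul _ measurable_density (measurable_weight ν)]
  rw [lintegral_withDensity_eq_lintegral_mul_non_measurable _
      (measurable_density.mul (measurable_weight ν))
      (Filter.Eventually.of_forall fun x => ENNReal.mul_lt_top ENNReal.ofReal_lt_top
        ENNReal.ofReal_lt_top)]
  refine le_trans ?_ (lintegral_mono_set hsub)
  rw [← lintegral_const_mul' _ _ ENNReal.ofReal_ne_top]
  refine setLIntegral_mono' measurableSet_ball fun x hx => ?_
  simp only [Pi.mul_apply]
  gcongr
  rw [← ENNReal.ofReal_mul (by positivity)]
  refine ENNReal.ofReal_le_ofReal ?_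
  rw [mem_ball, dist_eq_norm] at hx
  have h1 : ‖x‖ ≤ 1 - s := by
    have := norm_add_le (x - z) z
    rw [sub_add_cancel] at this
    linarith
  have h2 : s ≤ 1 - ‖x‖ ^ 2 := by nlinarith [norm_nonneg x]
  have h3 : 0 < 1 - ‖x‖ ^ 2 := lt_of_lt_of_le hs h2
  obtain ⟨m, rfl⟩ : ∃ m, ν = m + 2 := ⟨ν - 2, by omega⟩
  have h4 : 1 / (Real.pi * (1 - ‖x‖ ^ 2) ^ 2) * ((((m + 2 : ℕ) : ℝ) - 1) * (1 - ‖x‖ ^ 2) ^ (m + 2))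
      = ((m : ℝ) + 1) * ((1 - ‖x‖ ^ 2) ^ m / Real.pi) := by
    have := Real.pi_pos
    push_cast
    field_simp
    ring
  rw [h4, Nat.add_sub_cancel]
  have h5 : s ^ m / Real.pi ≤ (1 - ‖x‖ ^ 2) ^ m / Real.pi := by gcongr
  have h6 : 0 ≤ (1 - ‖x‖ ^ 2) ^ m / Real.pi := by positivity
  nlinarith [Nat.cast_nonneg (α := ℝ) m]

lemma pointwise_bound {ν : ℕ} (hν : 2 ≤ ν) {F : ℂ → ℂ}
    (hF : DifferentiableOn ℂ F (ball 0 1)) {z : ℂ} (hz : z ∈ ball (0 : ℂ) 1) :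
    ENNReal.ofReal ((1 - ‖z‖ ^ 2) ^ ν) * ‖F z‖ₑ ^ 2 ≤
      ENNReal.ofReal (4 ^ ν) * ∫⁻ x, ‖F x‖ₑ ^ 2 ∂iotaW ν := by
  rw [mem_ball_zero_iff] at hz
  set s : ℝ := (1 - ‖z‖) / 2 with hs
  have hs0 : 0 < s := by rw [hs]; linarith
  have hsz : ‖z‖ + 2 * s ≤ 1 := by rw [hs]; linarith
  have hsub : ball z s ⊆ ball 0 1 := by
    intro x hx
    rw [mem_ball, dist_eq_norm] at hx
    rw [mem_ball_zero_iff]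
    have := norm_add_le (x - z) z
    rw [sub_add_cancel] at this
    linarith
  have h1 := lintegral_iotaW_ge hν (fun x => ‖F x‖ₑ ^ 2) hs0 hsz
  have h2 := submean hs0 (hF.mono hsub)
  have h3 : (1 - ‖z‖ ^ 2) ^ ν ≤ 4 ^ ν * (s ^ (ν - 2) / Real.pi * (Real.pi * s ^ 2)) := by
    have e : s ^ (ν - 2) / Real.pi * (Real.pi * s ^ 2) = s ^ ν := by
      have := Real.pi_pos
      obtain ⟨m, rfl⟩ : ∃ m, ν = m + 2 := ⟨ν - 2, by omega⟩
      rw [Nat.add_sub_cancel]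
      field_simp
      ring
    rw [e, ← mul_pow]
    have : 0 ≤ 1 - ‖z‖ ^ 2 := by nlinarith [norm_nonneg z]
    gcongr
    rw [hs]
    nlinarith [norm_nonneg z]
  calc ENNReal.ofReal ((1 - ‖z‖ ^ 2) ^ ν) * ‖F z‖ₑ ^ 2
      ≤ ENNReal.ofReal (4 ^ ν * (s ^ (ν - 2) / Real.pi * (Real.pi * s ^ 2))) * ‖F z‖ₑ ^ 2 := by
        gcongr
    _ = ENNReal.ofReal (4 ^ ν) * (ENNReal.ofReal (s ^ (ν - 2) / Real.pi) *
          (‖F z‖ₑ ^ 2 * ENNReal.ofReal (Real.pi * s ^ 2))) := by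
        have := Real.pi_pos
        rw [ENNReal.ofReal_mul (by positivity), ENNReal.ofReal_mul (by positivity)]
        ring
    _ ≤ _ := by gcongr; exact (mul_le_mul_right h2 _).trans h1

/-- The classes in `L²(dι_ν)` that have a representative holomorphic on the unit disc. -/
def bergman (ν : ℕ) : Submodule ℂ (Lp ℂ 2 (iotaW ν)) where
  carrier := {f | ∃ F : ℂ → ℂ, DifferentiableOn ℂ F (ball 0 1) ∧ f =ᵐ[iotaW ν] F}
  zero_mem' := ⟨0, differentiableOn_const 0, Lp.coeFn_zero _ _ _⟩
  add_mem' := by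
    rintro f g ⟨F, hF, hfF⟩ ⟨G, hG, hgG⟩
    exact ⟨F + G, hF.add hG, (Lp.coeFn_add f g).trans (hfF.add hgG)⟩
  smul_mem' := by
    rintro c f ⟨F, hF, hfF⟩
    exact ⟨c • F, hF.const_smul c, (Lp.coeFn_smul c f).trans (hfF.const_smul c)⟩

lemma Lp_bound {ν : ℕ} (hν : 2 ≤ ν) (f : Lp ℂ 2 (iotaW ν)) {F : ℂ → ℂ}
    (hF : DifferentiableOn ℂ F (ball 0 1)) (hfF : f =ᵐ[iotaW ν] F)
    {z : ℂ} (hz : z ∈ ball (0 : ℂ) 1) :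
    (1 - ‖z‖ ^ 2) ^ ν * ‖F z‖ ^ 2 ≤ 4 ^ ν * ‖f‖ ^ 2 := by
  have h := pointwise_bound hν hF hz
  have e : ∫⁻ x, ‖F x‖ₑ ^ 2 ∂iotaW ν = ‖f‖ₑ ^ 2 := by
    rw [Lp.enorm_def, eLpNorm_congr_ae hfF]
    have := eLpNorm_nnreal_pow_eq_lintegral (f := F) (μ := iotaW ν) (p := 2) two_ne_zero
    simp only [NNReal.coe_ofNat, ENNReal.coe_ofNat, ENNReal.rpow_ofNat] at this
    exact this.symm
  have hz' : 0 ≤ 1 - ‖z‖ ^ 2 := by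
    rw [mem_ball_zero_iff] at hz; nlinarith [norm_nonneg z]
  rw [e, ← ofReal_norm, ← ofReal_norm, ← ENNReal.ofReal_pow (norm_nonneg _),
    ← ENNReal.ofReal_pow (norm_nonneg _), ← ENNReal.ofReal_mul (by positivity),
    ← ENNReal.ofReal_mul (by positivity)] at h
  exact (ENNReal.ofReal_le_ofReal_iff (by positivity)).1 h

/-- Needed for the completeness of the weighted Bergman space. -/
lemma isClosed_bergman (ν : ℕ) : IsClosed (bergman ν : Set (Lp ℂ 2 (iotaW ν))) := by
  by_cases hν : 2 ≤ ν
  swap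
  · have : (bergman ν : Set (Lp ℂ 2 (iotaW ν))) = Set.univ := by
      refine Set.eq_univ_of_forall fun f => ⟨0, differentiableOn_const 0, ?_⟩
      have h0 : ∀ g : ℂ → ℂ, g =ᵐ[iotaW ν] 0 := by
        intro g; rw [iotaW_eq_zero hν]; exact ae_zero.le (Filter.mem_bot)
      exact h0 f
    rw [this]; exact isClosed_univ
  refine IsSeqClosed.isClosed fun x f hx hlim => ?_
  choose F hF hxF using hx
  have hpos : ∀ z ∈ ball (0 : ℂ) 1, 0 < 1 - ‖z‖ ^ 2 := by
    intro z hz; rw [mem_ball_zero_iff] at hz; nlinarith [norm_nonneg z]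
  have hb : ∀ m n, ∀ z ∈ ball (0 : ℂ) 1,
      (1 - ‖z‖ ^ 2) ^ ν * ‖F m z - F n z‖ ^ 2 ≤ 4 ^ ν * ‖x m - x n‖ ^ 2 := fun m n z hz =>
    Lp_bound hν (x m - x n) ((hF m).sub (hF n)) ((Lp.coeFn_sub _ _).trans ((hxF m).sub (hxF n))) hz
  have huc : ∀ K ⊆ ball (0 : ℂ) 1, IsCompact K → UniformCauchySeqOn F Filter.atTop K := by
    intro K hK hKc
    rcases K.eq_empty_or_nonempty with rfl | hne
    · intro u hu; simp
    obtain ⟨z₀, hz₀, hmin⟩ := hKc.exists_isMinOn (f := fun z : ℂ => 1 - ‖z‖ ^ 2) hne (by fun_prop)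
    have hc := hpos z₀ (hK hz₀)
    rw [Metric.uniformCauchySeqOn_iff]
    intro ε hε
    have hx' : CauchySeq x := hlim.cauchySeq
    obtain ⟨N, hN⟩ := Metric.cauchySeq_iff.1 hx'
      (Real.sqrt ((1 - ‖z₀‖ ^ 2) ^ ν * ε ^ 2 / 4 ^ ν)) (by positivity)
    refine ⟨N, fun m hm n hn z hz => ?_⟩
    have h1 := hb m n z (hK hz)
    have h2 := hN m hm n hn
    rw [dist_eq_norm] at h2 ⊢
    rw [Real.lt_sqrt (norm_nonneg _), lt_div_iff₀ (by positivity)] at h2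
    have h3 : (1 - ‖z₀‖ ^ 2) ^ ν ≤ (1 - ‖z‖ ^ 2) ^ ν := pow_le_pow_left₀ hc.le (hmin hz) ν
    have h4 : (1 - ‖z₀‖ ^ 2) ^ ν * ‖F m z - F n z‖ ^ 2 < (1 - ‖z₀‖ ^ 2) ^ ν * ε ^ 2 := by
      have : (1 - ‖z₀‖ ^ 2) ^ ν * ‖F m z - F n z‖ ^ 2 ≤ (1 - ‖z‖ ^ 2) ^ ν * ‖F m z - F n z‖ ^ 2 := by
        gcongr
      linarith
    have h5 := lt_of_mul_lt_mul_left h4 (by positivity)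
    exact lt_of_pow_lt_pow_left₀ 2 hε.le h5
  have hptw : ∀ z ∈ ball (0 : ℂ) 1, ∃ w, Filter.Tendsto (fun n => F n z) Filter.atTop (nhds w) := by
    intro z hz
    have := huc {z} (by simpa using hz) isCompact_singleton
    exact cauchySeq_tendsto_of_complete (this.cauchy_map (Set.mem_singleton z))
  choose! G hG using hptw
  have hloc : TendstoLocallyUniformlyOn F G Filter.atTop (ball 0 1) := by
    rw [tendstoLocallyUniformlyOn_iff_forall_isCompact isOpen_ball]
    intro K hK hKc
    exact (huc K hK hKc).tendstoUniformlyOn_of_tendsto fun z hz => hG z (hK hz)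
  refine ⟨G, hloc.differentiableOn (Filter.Eventually.of_forall hF) isOpen_ball, ?_⟩
  obtain ⟨ns, hns, hae⟩ := (tendstoInMeasure_of_tendsto_Lp hlim).exists_seq_tendsto_ae
  have hall : ∀ᵐ z ∂iotaW ν, ∀ n, x n z = F n z := ae_all_iff.2 hxF
  filter_upwards [hae, hall, ae_iotaW_mem ν] with z h1 h2 h3
  simp only [h2] at h1
  exact tendsto_nhds_unique h1 ((hG z h3).comp hns.tendsto_atTop)

/-- The weighted Bergman space `ℋ_ν` (for `ν ≥ 2`): holomorphic functions on the unit disc that are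
square integrable for `dι_ν`, with the inner product of `L²(dι_ν)` (conjugate-linear in the first
argument, as everywhere in Mathlib). -/
def H (ν : ℕ) : Type := bergman ν

instance (ν : ℕ) : NormedAddCommGroup (H ν) := inferInstanceAs (NormedAddCommGroup (bergman ν))

instance (ν : ℕ) : InnerProductSpace ℂ (H ν) := inferInstanceAs (InnerProductSpace ℂ (bergman ν))

instance (ν : ℕ) : CompleteSpace (H ν) :=
  (isClosed_bergman ν).completeSpace_coe

/-- The inclusion of `ℋ_ν` into `L²(dι_ν)`. -/
def toLp (ν : ℕ) : H ν →ₗᵢ[ℂ] Lp ℂ 2 (iotaW ν) := (bergman ν).subtypeₗᵢ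

lemma toLp_mem {ν : ℕ} (u : H ν) :
    ∃ F : ℂ → ℂ, DifferentiableOn ℂ F (ball 0 1) ∧ toLp ν u =ᵐ[iotaW ν] F :=
  Subtype.property (p := fun x => x ∈ bergman ν) u

/-- The holomorphic function on the disc given by an element of `ℋ_ν`. For `ν ≥ 2` its values on the
unit disc are unique; its values elsewhere are irrelevant. -/
def fn {ν : ℕ} (u : H ν) : ℂ → ℂ := (toLp_mem u).choose

lemma differentiableOn_fn {ν : ℕ} (u : H ν) : DifferentiableOn ℂ (fn u) (ball 0 1) :=
  (toLp_mem u).choose_spec.1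

lemma toLp_ae_eq_fn {ν : ℕ} (u : H ν) : toLp ν u =ᵐ[iotaW ν] fn u :=
  (toLp_mem u).choose_spec.2

/-- The open unit disc. -/
abbrev Disc : Type := ball (0 : ℂ) 1

lemma norm_one_sub_ge (y : Disc) {x : ℂ} (hx : x ∈ ball (0 : ℂ) 1) :
    1 - ‖(y : ℂ)‖ ≤ ‖1 - x * conj (y : ℂ)‖ := by
  rw [mem_ball_zero_iff] at hx
  have h1 : ‖x * conj (y : ℂ)‖ ≤ ‖(y : ℂ)‖ := by
    rw [norm_mul, RCLike.norm_conj]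
    nlinarith [norm_nonneg (y : ℂ)]
  have h2 := norm_sub_norm_le (1 : ℂ) (x * conj (y : ℂ))
  rw [norm_one] at h2
  linarith

lemma differentiableOn_kernel (ν : ℕ) (y : Disc) :
    DifferentiableOn ℂ (fun x : ℂ => ((1 - x * conj (y : ℂ)) ^ ν)⁻¹) (ball 0 1) := by
  refine DifferentiableOn.inv (by fun_prop) fun x hx => pow_ne_zero _ ?_
  have h := norm_one_sub_ge y hx
  have hy : ‖(y : ℂ)‖ < 1 := mem_ball_zero_iff.1 y.2
  exact norm_pos_iff.1 (by linarith)

lemma isFiniteMeasure_iotaW (ν : ℕ) : IsFiniteMeasure (iotaW ν) := by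
  by_cases hν : 2 ≤ ν
  swap
  · rw [iotaW_eq_zero hν]; infer_instance
  unfold iotaW iota
  rw [← withDensity_mul _ measurable_density (measurable_weight ν)]
  refine isFiniteMeasure_withDensity (ne_of_lt ?_)
  refine lt_of_le_of_lt (setLIntegral_mono' (g := fun _ => ENNReal.ofReal (((ν : ℝ) - 1) / Real.pi))
    measurableSet_ball fun x hx => ?_) ?_
  · simp only [Pi.mul_apply]
    rw [mem_ball_zero_iff] at hx
    have h3 : 0 < 1 - ‖x‖ ^ 2 := by nlinarith [norm_nonneg x]
    have h4 : 1 - ‖x‖ ^ 2 ≤ 1 := by nlinarith [norm_nonneg x]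
    rw [← ENNReal.ofReal_mul (by positivity)]
    refine ENNReal.ofReal_le_ofReal ?_
    obtain ⟨m, rfl⟩ : ∃ m, ν = m + 2 := ⟨ν - 2, by omega⟩
    have h5 : 1 / (Real.pi * (1 - ‖x‖ ^ 2) ^ 2) *
        ((((m + 2 : ℕ) : ℝ) - 1) * (1 - ‖x‖ ^ 2) ^ (m + 2))
        = ((((m + 2 : ℕ) : ℝ) - 1) / Real.pi) * (1 - ‖x‖ ^ 2) ^ m := by
      have := Real.pi_pos
      field_simp
      ring
    rw [h5]
    have h6 : 0 ≤ (((m + 2 : ℕ) : ℝ) - 1) / Real.pi := by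
      have := Real.pi_pos
      push_cast
      exact div_nonneg (by linarith [Nat.cast_nonneg (α := ℝ) m]) this.le
    exact mul_le_of_le_one_right h6 (pow_le_one₀ h3.le h4)
  · rw [setLIntegral_const]
    exact ENNReal.mul_lt_top ENNReal.ofReal_lt_top measure_ball_lt_top

lemma memLp_kernel (ν : ℕ) (y : Disc) :
    MemLp (fun x : ℂ => ((1 - x * conj (y : ℂ)) ^ ν)⁻¹) 2 (iotaW ν) := by
  have := isFiniteMeasure_iotaW ν
  have hy : ‖(y : ℂ)‖ < 1 := mem_ball_zero_iff.1 y.2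
  refine MemLp.of_bound (by fun_prop) (((1 - ‖(y : ℂ)‖) ^ ν)⁻¹) ?_
  filter_upwards [ae_iotaW_mem ν] with x hx
  rw [norm_inv, norm_pow]
  have h0 : 0 < 1 - ‖(y : ℂ)‖ := by linarith
  gcongr
  exact norm_one_sub_ge y hx

/-- The reproducing kernel function `K_y(x) = (1 - x ȳ)^(-ν)` as an element of `ℋ_ν`. -/
def kernel (ν : ℕ) (y : Disc) : H ν :=
  ⟨(memLp_kernel ν y).toLp _, _, differentiableOn_kernel ν y, (memLp_kernel ν y).coeFn_toLp⟩

/-- The covariant symbol `R_ν(A)(z) = A(z, z) (1 - |z|²)^ν`, where `A(x, y) = A(K_y)(x)` is the integral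
kernel of the operator `A`. -/
def covariantSymbol (ν : ℕ) (A : H ν →L[ℂ] H ν) (z : Disc) : ℂ :=
  fn (A (kernel ν z)) z * (1 - ‖(z : ℂ)‖ ^ 2) ^ ν

lemma exists_dominated {p : ℝ≥0∞} [hp : Fact (1 ≤ p)] (f : Lp ℂ p iota) :
    ∃ (g : ℂ → ℝ) (M : ℝ), Integrable g iota ∧ 0 ≤ M ∧ (∀ x, 0 ≤ g x) ∧
      ∀ᵐ x ∂iota, ‖f x‖ ≤ g x + M := by
  by_cases hpt : p = ∞
  · subst hpt
    refine ⟨0, (eLpNormEssSup f iota).toReal, integrable_zero _ _ _, ENNReal.toReal_nonneg,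
      fun _ => le_rfl, ?_⟩
    have hfin : eLpNormEssSup f iota < ∞ := by
      have := Lp.eLpNorm_lt_top f
      rwa [eLpNorm_exponent_top] at this
    filter_upwards [enorm_ae_le_eLpNormEssSup f iota] with x hx
    have := ENNReal.toReal_mono hfin.ne hx
    simpa using this
  · have hp0 : p ≠ 0 := (lt_of_lt_of_le one_pos hp.out).ne'
    refine ⟨fun x => ‖f x‖ ^ p.toReal, 1, (Lp.memLp f).integrable_norm_rpow hp0 hpt, zero_le_one,
      fun x => by positivity, Filter.Eventually.of_forall fun x => ?_⟩
    have h1 : 1 ≤ p.toReal := by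
      have := ENNReal.toReal_mono hpt hp.out
      simpa using this
    rcases le_total ‖f x‖ 1 with h | h
    · have : 0 ≤ ‖f x‖ ^ p.toReal := by positivity
      linarith
    · have := Real.self_le_rpow_of_one_le h h1
      linarith

/-- The form `(u, v) ↦ ∫ conj(f u) v dι_ν` converges absolutely and is bounded on `ℋ_ν`. -/
lemma exists_bound (ν : ℕ) {p : ℝ≥0∞} [hp : Fact (1 ≤ p)] (f : Lp ℂ p iota) :
    ∃ C : ℝ, ∀ u v : H ν,
      Integrable (fun z => conj (f z * toLp ν u z) * toLp ν v z) (iotaW ν) ∧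
      ‖∫ z, conj (f z * toLp ν u z) * toLp ν v z ∂iotaW ν‖ ≤ C * ‖u‖ * ‖v‖ := by
  by_cases hν : 2 ≤ ν
  swap
  · refine ⟨0, fun u v => ?_⟩
    have h : ∀ g : ℂ → ℂ, Integrable g (iotaW ν) ∧ ‖∫ z, g z ∂iotaW ν‖ ≤ 0 := by
      intro g; rw [iotaW_eq_zero hν]; simp
    rw [zero_mul, zero_mul]
    exact h _
  obtain ⟨g, M, hg, hM, hg0, hfg⟩ := exists_dominated f
  have hν1 : (0 : ℝ) ≤ (ν : ℝ) - 1 := by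
    have : (2 : ℝ) ≤ ν := by exact_mod_cast hν
    linarith
  refine ⟨4 ^ ν * (((ν : ℝ) - 1) * ∫ x, g x ∂iota) + M, fun u v => ?_⟩
  have hbd : ∀ (w : H ν), ∀ z ∈ ball (0 : ℂ) 1, (1 - ‖z‖ ^ 2) ^ ν * ‖fn w z‖ ^ 2 ≤ 4 ^ ν * ‖w‖ ^ 2 := by
    intro w z hz
    have := Lp_bound hν (toLp ν w) (differentiableOn_fn w) (toLp_ae_eq_fn w) hz
    rwa [LinearIsometry.norm_map] at this
  have hG1 : Integrable (fun z => g z * ((1 - ‖z‖ ^ 2) ^ ν)⁻¹) (iotaW ν) ∧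
      ∫ z, g z * ((1 - ‖z‖ ^ 2) ^ ν)⁻¹ ∂iotaW ν = ((ν : ℝ) - 1) * ∫ x, g x ∂iota := by
    have hc : (fun z => (ENNReal.ofReal (((ν : ℝ) - 1) * (1 - ‖z‖ ^ 2) ^ ν)).toReal •
        (g z * ((1 - ‖z‖ ^ 2) ^ ν)⁻¹)) =ᵐ[iota] fun z => ((ν : ℝ) - 1) * g z := by
      filter_upwards [ae_iota_mem] with z hz
      rw [mem_ball_zero_iff] at hz
      have h3 : 0 < 1 - ‖z‖ ^ 2 := by nlinarith [norm_nonneg z]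
      rw [ENNReal.toReal_ofReal (by positivity), smul_eq_mul]
      have : (1 - ‖z‖ ^ 2) ^ ν ≠ 0 := by positivity
      field_simp
    constructor
    · unfold iotaW
      rw [integrable_withDensity_iff_integrable_smul' (measurable_weight ν)
        (Filter.Eventually.of_forall fun _ => ENNReal.ofReal_lt_top)]
      exact (hg.const_mul _).congr hc.symm
    · unfold iotaW
      rw [integral_withDensity_eq_integral_toReal_smul (measurable_weight ν)
        (Filter.Eventually.of_forall fun _ => ENNReal.ofReal_lt_top), integral_congr_ae hc,
        integral_const_mul]
  have hu2 : MemLp (toLp ν u) 2 (iotaW ν) := Lp.memLp _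
  have hv2 : MemLp (toLp ν v) 2 (iotaW ν) := Lp.memLp _
  have hG2 : Integrable (fun z => ‖toLp ν u z‖ * ‖toLp ν v z‖) (iotaW ν) :=
    hu2.norm.integrable_mul hv2.norm
  have hG2' : ∫ z, ‖toLp ν u z‖ * ‖toLp ν v z‖ ∂iotaW ν ≤ ‖u‖ * ‖v‖ := by
    have h := integral_mul_norm_le_Lp_mul_Lq (μ := iotaW ν) Real.HolderConjugate.two_two
      (f := toLp ν u) (g := toLp ν v) (by simpa using hu2) (by simpa using hv2)
    have e : ∀ w : H ν, (∫ z, ‖toLp ν w z‖ ^ (2 : ℝ) ∂iotaW ν) ^ (1 / (2 : ℝ)) = ‖w‖ := by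
      intro w
      rw [← (toLp ν).norm_map w, Lp.norm_def, (Lp.memLp (toLp ν w)).eLpNorm_eq_integral_rpow_norm
        two_ne_zero ENNReal.ofNat_ne_top, ENNReal.toReal_ofReal (by positivity)]
      norm_num
    rwa [e, e] at h
  have hdom : ∀ᵐ z ∂iotaW ν, ‖conj (f z * toLp ν u z) * toLp ν v z‖ ≤
      4 ^ ν * ‖u‖ * ‖v‖ * (g z * ((1 - ‖z‖ ^ 2) ^ ν)⁻¹) + M * (‖toLp ν u z‖ * ‖toLp ν v z‖) := by
    filter_upwards [ae_iotaW_mem ν, (iotaW_ac ν).ae_le hfg, toLp_ae_eq_fn u, toLp_ae_eq_fn v]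
      with z hz h1 h2 h3
    rw [norm_mul, RCLike.norm_conj, norm_mul, h2, h3]
    have hu := hbd u z hz
    have hv := hbd v z hz
    rw [mem_ball_zero_iff] at hz
    have h4 : 0 < 1 - ‖z‖ ^ 2 := by nlinarith [norm_nonneg z]
    have h5 : 0 < (1 - ‖z‖ ^ 2) ^ ν := by positivity
    have h6 : ‖fn u z‖ * ‖fn v z‖ ≤ 4 ^ ν * ‖u‖ * ‖v‖ * ((1 - ‖z‖ ^ 2) ^ ν)⁻¹ := by
      rw [← div_eq_mul_inv, le_div_iff₀ h5]
      refine le_of_sq_le_sq ?_ (by positivity)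
      calc (‖fn u z‖ * ‖fn v z‖ * (1 - ‖z‖ ^ 2) ^ ν) ^ 2
          = ((1 - ‖z‖ ^ 2) ^ ν * ‖fn u z‖ ^ 2) * ((1 - ‖z‖ ^ 2) ^ ν * ‖fn v z‖ ^ 2) := by ring
        _ ≤ (4 ^ ν * ‖u‖ ^ 2) * (4 ^ ν * ‖v‖ ^ 2) := by gcongr
        _ = _ := by ring
    calc ‖f z‖ * ‖fn u z‖ * ‖fn v z‖ ≤ (g z + M) * (‖fn u z‖ * ‖fn v z‖) := by
          rw [mul_assoc]; gcongr
      _ = g z * (‖fn u z‖ * ‖fn v z‖) + M * (‖fn u z‖ * ‖fn v z‖) := by ring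
      _ ≤ g z * (4 ^ ν * ‖u‖ * ‖v‖ * ((1 - ‖z‖ ^ 2) ^ ν)⁻¹) + M * (‖fn u z‖ * ‖fn v z‖) := by
          gcongr; exact hg0 z
      _ = _ := by ring
  have hGi := (hG1.1.const_mul (4 ^ ν * ‖u‖ * ‖v‖)).add (hG2.const_mul M)
  have hfm : AEStronglyMeasurable f (iotaW ν) := (Lp.aestronglyMeasurable f).mono_ac (iotaW_ac ν)
  refine ⟨hGi.mono' ?_ hdom, ?_⟩
  · exact (continuous_conj.comp_aestronglyMeasurable (hfm.mul hu2.1)).mul hv2.1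
  · refine (norm_integral_le_of_norm_le hGi hdom).trans ?_
    rw [integral_add' (hG1.1.const_mul _) (hG2.const_mul M), integral_const_mul,
      integral_const_mul, hG1.2]
    have := mul_le_mul_of_nonneg_left hG2' hM
    nlinarith

/-- The bounded sesquilinear form `(u, v) ↦ ∫ conj(f u) v dι_ν = ⟨f u, v⟩` on `ℋ_ν`. -/
def toeplitzForm (ν : ℕ) {p : ℝ≥0∞} [Fact (1 ≤ p)] (f : Lp ℂ p iota) :
    H ν →L⋆[ℂ] H ν →L[ℂ] ℂ :=
  (LinearMap.mk₂'ₛₗ (starRingEnd ℂ) (RingHom.id ℂ)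
    (fun u v : H ν =>
      ∫ z, conj (f z * toLp ν u z) * toLp ν v z ∂iotaW ν)
    (by
      intro u u' v
      rw [← integral_add ((exists_bound ν f).choose_spec u v).1
        ((exists_bound ν f).choose_spec u' v).1]
      refine integral_congr_ae ?_
      filter_upwards [Lp.coeFn_add (toLp ν u) (toLp ν u')] with z hz
      simp only [map_add, hz, Pi.add_apply, map_mul]
      ring)
    (by
      intro c u v
      rw [smul_eq_mul, ← integral_const_mul]
      refine integral_congr_ae ?_
      filter_upwards [Lp.coeFn_smul c (toLp ν u)] with z hz
      simp only [map_smul, hz, Pi.smul_apply, map_mul, smul_eq_mul]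
      ring)
    (by
      intro u v v'
      rw [← integral_add ((exists_bound ν f).choose_spec u v).1
        ((exists_bound ν f).choose_spec u v').1]
      refine integral_congr_ae ?_
      filter_upwards [Lp.coeFn_add (toLp ν v) (toLp ν v')] with z hz
      simp only [map_add, hz, Pi.add_apply]
      ring)
    (by
      intro c u v
      rw [RingHom.id_apply, smul_eq_mul, ← integral_const_mul]
      refine integral_congr_ae ?_
      filter_upwards [Lp.coeFn_smul c (toLp ν v)] with z hz
      simp only [map_smul, hz, Pi.smul_apply, smul_eq_mul]
      ring)).mkContinuous₂ (exists_bound ν f).choose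
    fun u v => ((exists_bound ν f).choose_spec u v).2

/-- The Toeplitz operator `T_f` on `ℋ_ν` with symbol `f ∈ L^p(𝔻, dι)`, the compression to `ℋ_ν` of the
multiplication by `f`: `⟨T_f u, v⟩ = ⟨f u, v⟩` in `L²(dι_ν)` for all `u, v ∈ ℋ_ν`. -/
def toeplitz (ν : ℕ) {p : ℝ≥0∞} [Fact (1 ≤ p)] (f : Lp ℂ p iota) : H ν →L[ℂ] H ν :=
  InnerProductSpace.continuousLinearMapOfBilin (toeplitzForm ν f)

lemma inner_toeplitz (ν : ℕ) {p : ℝ≥0∞} [Fact (1 ≤ p)] (f : Lp ℂ p iota) (u v : H ν) :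
    inner ℂ (toeplitz ν f u) v =
      ∫ z, conj (f z * toLp ν u z) * toLp ν v z ∂iotaW ν :=
  InnerProductSpace.continuousLinearMapOfBilin_apply _ _ _

/-- The adjoint `R_ν^*(f) = (ν - 1)⁻¹ T_f` of the covariant symbol map: tested on the rank one operator
`A = v ⊗ u^*`, for which `R_ν(A) = v ū (1 - |z|²)^ν`, the adjoint relation reads
`⟨R_ν^*(f) u, v⟩ = ∫ conj(f) R_ν(A) dι = (ν - 1)⁻¹ ∫ conj(f u) v dι_ν`. -/
def Rstar (ν : ℕ) {p : ℝ≥0∞} [Fact (1 ≤ p)] (f : Lp ℂ p iota) : H ν →L[ℂ] H ν :=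
  ((ν : ℂ) - 1)⁻¹ • toeplitz ν f

/-- The Berezin transform `B_ν = R_ν R_ν^*`. -/
def berezin (ν : ℕ) {p : ℝ≥0∞} [Fact (1 ≤ p)] (f : Lp ℂ p iota) : Disc → ℂ :=
  covariantSymbol ν (Rstar ν f)

/-- The Hilbert space tensor product `ℋ_μ ⊗ ℋ_ν`. -/
def HTensor (μ ν : ℕ) : Type := UniformSpace.Completion (H μ ⊗[ℂ] H ν)

instance (μ ν : ℕ) : NormedAddCommGroup (HTensor μ ν) :=
  inferInstanceAs (NormedAddCommGroup (UniformSpace.Completion (H μ ⊗[ℂ] H ν)))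

instance (μ ν : ℕ) : InnerProductSpace ℂ (HTensor μ ν) :=
  inferInstanceAs (InnerProductSpace ℂ (UniformSpace.Completion (H μ ⊗[ℂ] H ν)))

instance (μ ν : ℕ) : CompleteSpace (HTensor μ ν) :=
  inferInstanceAs (CompleteSpace (UniformSpace.Completion (H μ ⊗[ℂ] H ν)))

/-- The elementary tensor `u ⊗ v`. -/
def tmul {μ ν : ℕ} (u : H μ) (v : H ν) : HTensor μ ν :=
  ((u ⊗ₜ[ℂ] v : H μ ⊗[ℂ] H ν) : UniformSpace.Completion (H μ ⊗[ℂ] H ν))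

/-- The operator `A ⊗ I_ν`. -/
def tensorId {μ : ℕ} (ν : ℕ) (A : H μ →L[ℂ] H μ) : HTensor μ ν →L[ℂ] HTensor μ ν :=
  (A.rTensor (H ν)).completion

lemma tensorId_tmul {μ ν : ℕ} (A : H μ →L[ℂ] H μ) (u : H μ) (v : H ν) :
    tensorId ν A (tmul u v) = tmul (A u) v :=
  ContinuousLinearMap.completion_apply_coe _ _

/-- The action of `g = (a, b; conj b, conj a) ∈ SU(1,1)`, where `|a|² - |b|² = 1`, with weight `ν`:
`(g · F)(z) = (-b z + conj a)^(-ν) F((a z - conj b) / (-b z + conj a))`. -/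
def act (ν : ℕ) (a b : ℂ) (F : ℂ → ℂ) (z : ℂ) : ℂ :=
  ((-b * z + conj a) ^ ν)⁻¹ * F ((a * z - conj b) / (-b * z + conj a))

/-- `P : ℋ_μ ⊗ ℋ_ν → ℋ_{μ+ν+2k}` is the projection onto the `k`-th component of the decomposition of
`ℋ_μ ⊗ ℋ_ν`: an `SU(1,1)`-intertwining partial isometry onto `ℋ_{μ+ν+2k}`, i.e. `P P^* = I` and
`P (g u ⊗ g v) = g P (u ⊗ v)` for all `g ∈ SU(1,1)`. It is unique up to a scalar of modulus one, on
which the channel does not depend. -/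
structure IsComponentProjection (μ ν k : ℕ) (P : HTensor μ ν →L[ℂ] H (μ + ν + 2 * k)) : Prop where
  comp_adjoint : P ∘L ContinuousLinearMap.adjoint P = ContinuousLinearMap.id ℂ _
  intertwines : ∀ a b : ℂ, ‖a‖ ^ 2 - ‖b‖ ^ 2 = 1 → ∀ (u u' : H μ) (v v' : H ν),
    (∀ z ∈ ball (0 : ℂ) 1, fn u' z = act μ a b (fn u) z) →
    (∀ z ∈ ball (0 : ℂ) 1, fn v' z = act ν a b (fn v) z) →
    ∀ z ∈ ball (0 : ℂ) 1,
      fn (P (tmul u' v')) z =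
        act (μ + ν + 2 * k) a b (fn (P (tmul u v))) z

/-- The channel `A ↦ P (A ⊗ I_ν) P^*`. -/
def channel {μ ν k : ℕ} (P : HTensor μ ν →L[ℂ] H (μ + ν + 2 * k)) (A : H μ →L[ℂ] H μ) :
    H (μ + ν + 2 * k) →L[ℂ] H (μ + ν + 2 * k) :=
  P ∘L tensorId ν A ∘L ContinuousLinearMap.adjoint P

/-- The Pochhammer symbol `(x)_k = x (x + 1) ⋯ (x + k - 1)`. -/
def poch (x : ℝ) (k : ℕ) : ℝ := (ascPochhammer ℝ k).eval x

/-- The normalizing constant `C_{μ,ν,k} > 0` with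
`C_{μ,ν,k}^(-2) = k! (μ + ν + k - 1)_k / ((μ)_k (ν)_k)`, the squared norm of `(z - w)^k` in
`ℋ_μ ⊗ ℋ_ν`. -/
def normConst (μ ν k : ℕ) : ℝ :=
  Real.sqrt (poch μ k * poch ν k / (k.factorial * poch ((μ : ℝ) + ν + k - 1) k))

end

end SU11

/-!
The proof compares everything at the origin. If `P` is a component projection, its adjoint
intertwines the actions, so the diagonal subgroup forces `P* 1` to be a combination of the
`xᵖ yᵏ⁻ᵖ`, while the vanishing of `P` on the part of degree less than `k`, moved around by
translations, forces the coefficients to be those of a multiple of `(x - y)ᵏ`. As `P P* = 1`, the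
multiple is `C_{μ,ν,k}` up to a phase. Conversely, the translates of `(x - y)ᵏ` have the Gram matrix
of the kernels of weight `μ + ν + 2k`, up to a constant, which gives existence.

The covariant symbol at `z` is the matrix coefficient at the translate `g_z · 1` of the constant
function, so that of the channel applied to `A` is `C²` times the sum over `i` of
`C(k,i)² ‖yᵏ⁻ⁱ‖² ⟨g_z xⁱ, A g_z xⁱ⟩`. For `A = R_μ*(f)` the inner product is the integral of
`f t^μ (1 - t)ⁱ` against the invariant measure, `t = (1 - |z|²)(1 - |x|²) / |1 - x z̄|²`. Expanding
`(1 - t)ⁱ` turns it into Berezin transforms of `f`, and the coefficients are summed by Vandermonde's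
identity.
-/

namespace SU11

open MeasureTheory Metric Complex ComplexConjugate
open scoped ENNReal NNReal TensorProduct

noncomputable section

/-- The `n`-th Taylor coefficient of `F` at the origin. -/
def taylorCoeff (F : ℂ → ℂ) (n : ℕ) : ℂ := iteratedDeriv n F 0 / n.factorial

section TaylorCoeff

variable {F : ℂ → ℂ} (hF : DifferentiableOn ℂ F (ball 0 1)) {w : ℂ} (hw : w ∈ ball (0 : ℂ) 1)
include hF hw

lemma hasSum_taylorCoeff_mul_pow : HasSum (fun n => taylorCoeff F n * w ^ n) (F w) := by
  refine (hasSum_taylorSeries_on_ball hF hw).congr_fun fun n => ?_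
  rw [taylorCoeff, sub_zero, smul_eq_mul, smul_eq_mul]
  ring

lemma taylorCoeff_comp_mul (n : ℕ) :
    taylorCoeff (fun ζ => F (w * ζ)) n = w ^ n * taylorCoeff F n := by
  have hmaps : Set.MapsTo (w * ·) (ball (0 : ℂ) 1) (ball 0 1) := fun ζ hζ => by
    rw [mem_ball_zero_iff] at hζ hw ⊢
    rw [norm_mul]
    exact mul_lt_one_of_nonneg_of_lt_one_left (norm_nonneg w) hw hζ.le
  have h0 : (0 : ℂ) ∈ ball 0 1 := mem_ball_self one_pos
  have h := iteratedDerivWithin_comp_const_smul (n := n) h0 isOpen_ball.uniqueDiffOn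
    (hF.contDiffOn isOpen_ball) w hmaps
  rw [mul_zero, smul_eq_mul, iteratedDerivWithin_of_isOpen isOpen_ball h0,
    iteratedDerivWithin_of_isOpen isOpen_ball h0] at h
  rw [taylorCoeff, h, taylorCoeff, mul_div_assoc]

lemma circleAverage_conj_pow_mul (n : ℕ) :
    Real.circleAverage (fun ζ => conj (w * ζ) ^ n * F (w * ζ)) 0 1 =
      (‖w‖ : ℂ) ^ (2 * n) * taylorCoeff F n := by
  have hG : DifferentiableOn ℂ (fun ζ => F (w * ζ)) (closedBall 0 1) := by
    refine hF.comp (by fun_prop) fun ζ hζ => ?_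
    rw [mem_closedBall_zero_iff] at hζ
    rw [mem_ball_zero_iff] at hw ⊢
    rw [norm_mul]
    exact (mul_le_of_le_one_right (norm_nonneg w) hζ).trans_lt hw
  have hcauchy := hG.circleIntegral_one_div_sub_center_pow_smul one_pos n
  have hcircle : ∮ ζ in C(0, 1), (ζ - 0)⁻¹ • (conj (w * ζ) ^ n * F (w * ζ)) =
      conj w ^ n * ∮ ζ in C(0, 1), (1 / (ζ - 0) ^ (n + 1)) • F (w * ζ) := by
    rw [← smul_eq_mul, ← circleIntegral.integral_smul]
    refine circleIntegral.integral_congr zero_le_one fun ζ hζ => ?_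
    have hζ' : conj ζ = ζ⁻¹ := (inv_eq_conj (mem_sphere_zero_iff_norm.1 hζ)).symm
    simp only [sub_zero, smul_eq_mul, map_mul, hζ', mul_pow, one_div, pow_succ, inv_pow, mul_inv]
    ring
  have := two_pi_I_ne_zero
  rw [Real.circleAverage_eq_circleIntegral one_ne_zero, hcircle, hcauchy, pow_mul, ← conj_mul',
    mul_pow, mul_assoc (_ ^ n) (_ ^ n), ← taylorCoeff_comp_mul hF hw, taylorCoeff,
    smul_eq_mul, smul_eq_mul]
  field_simp

end TaylorCoeff

section RotationInvariant

/-- A measure on `ℂ` preserved by all rotations around the origin. -/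
def IsRotationInvariant (μ : Measure ℂ) : Prop :=
  ∀ c : Circle, MeasurePreserving (rotation c) μ μ

variable {μ : Measure ℂ}

lemma IsRotationInvariant.withDensity_norm (hμ : IsRotationInvariant μ) {ρ : ℝ → ℝ≥0∞}
    (hρ : Measurable ρ) : IsRotationInvariant (μ.withDensity fun z => ρ ‖z‖) := by
  refine fun c => ⟨(hμ c).measurable, Measure.ext fun s hs => ?_⟩
  have hρ' : Measurable fun z : ℂ => ρ ‖z‖ := hρ.comp measurable_norm
  rw [Measure.map_apply (hμ c).measurable hs, withDensity_apply _ hs,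
    withDensity_apply _ ((hμ c).measurable hs), ← (hμ c).setLIntegral_comp_preimage hs hρ']
  simp only [LinearIsometryEquiv.norm_map]

lemma isRotationInvariant_volume_ball (R : ℝ) :
    IsRotationInvariant (volume.restrict (ball (0 : ℂ) R)) := fun c => by
  have h := (rotation c).measurePreserving.restrict_preimage (measurableSet_ball (x := 0) (ε := R))
  rwa [(rotation c).preimage_ball, map_zero] at h

variable (hμ : IsRotationInvariant μ) [SFinite μ]
include hμ

lemma IsRotationInvariant.integral_circleAverage {G : ℂ → ℂ} (hG : Integrable G μ) :
    ∫ z, Real.circleAverage (fun ζ => G (z * ζ)) 0 1 ∂μ = ∫ z, G z ∂μ := by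
  set τ : Measure ℝ := volume.restrict (Set.uIoc 0 (2 * Real.pi)) with hτ
  have : IsFiniteMeasure τ := by
    rw [hτ, Set.uIoc]
    infer_instance
  have hshear : MeasurePreserving (fun p : ℝ × ℂ => (p.1, rotation (Circle.exp p.1) p.2))
      (τ.prod μ) (τ.prod μ) := by
    refine (MeasurePreserving.id τ).skew_product ?_ (Filter.Eventually.of_forall fun θ =>
      (hμ (Circle.exp θ)).map_eq)
    simp only [Function.uncurry_def, rotation_apply]
    fun_prop
  have hint : Integrable (Function.uncurry fun (θ : ℝ) (z : ℂ) => G (z * circleMap 0 1 θ))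
      (τ.prod μ) := by
    refine (hshear.integrable_comp_of_integrable (hG.comp_snd τ)).congr
      (Filter.Eventually.of_forall fun p => ?_)
    simp [Function.uncurry_def, circleMap, mul_comm]
  have hrot (θ : ℝ) : ∫ z, G (z * circleMap 0 1 θ) ∂μ = ∫ z, G z ∂μ := by
    simpa [circleMap, mul_comm] using
      (hμ (Circle.exp θ)).integral_comp (rotation _).toHomeomorph.measurableEmbedding G
  simp only [Real.circleAverage_def, integral_smul, ← intervalIntegral_integral_swap hint, hrot,
    intervalIntegral.integral_const, sub_zero]
  exact inv_smul_smul₀ Real.two_pi_pos.ne' _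

/-- Orthogonality of the monomials for rotation invariant measures: averaging over rotations
replaces `z̄ ^ n * F z` by `|z| ^ (2 * n)` times the `n`-th Taylor coefficient of `F`. -/
lemma IsRotationInvariant.integral_conj_pow_mul (hdisc : ∀ᵐ z ∂μ, z ∈ ball (0 : ℂ) 1)
    {F : ℂ → ℂ} (hF : DifferentiableOn ℂ F (ball 0 1)) {n : ℕ}
    (hint : Integrable (fun z => conj z ^ n * F z) μ) :
    ∫ z, conj z ^ n * F z ∂μ = ((∫ z, ‖z‖ ^ (2 * n) ∂μ : ℝ) : ℂ) * taylorCoeff F n := by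
  rw [← hμ.integral_circleAverage hint, ← integral_complex_ofReal, ← integral_mul_const]
  refine integral_congr_ae ?_
  filter_upwards [hdisc] with z hz
  rw [circleAverage_conj_pow_mul hF hz, ofReal_pow]

end RotationInvariant

/-! ### The weighted measures -/

section WeightedMeasure

lemma one_sub_norm_sq_pos {z : ℂ} (hz : z ∈ ball (0 : ℂ) 1) : 0 < 1 - ‖z‖ ^ 2 := by
  rw [mem_ball_zero_iff] at hz
  nlinarith [norm_nonneg z]

lemma one_lt_cast {ν : ℕ} [ν.AtLeastTwo] : (1 : ℝ) < ν := by
  exact_mod_cast Nat.AtLeastTwo.prop (n := ν)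

lemma toReal_weight {ν : ℕ} [ν.AtLeastTwo] {z : ℂ} (hz : z ∈ ball (0 : ℂ) 1) :
    (ENNReal.ofReal (((ν : ℝ) - 1) * (1 - ‖z‖ ^ 2) ^ ν)).toReal =
      ((ν : ℝ) - 1) * (1 - ‖z‖ ^ 2) ^ ν :=
  ENNReal.toReal_ofReal (mul_nonneg (sub_nonneg.2 one_lt_cast.le)
    (pow_nonneg (one_sub_norm_sq_pos hz).le ν))

variable (ν : ℕ) [ν.AtLeastTwo]

lemma integral_iotaW_eq_integral_iota (G : ℂ → ℂ) :
    ∫ z, G z ∂iotaW ν = ((ν : ℂ) - 1) * ∫ z, (1 - (‖z‖ : ℂ) ^ 2) ^ ν * G z ∂iota := by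
  unfold iotaW
  rw [integral_withDensity_eq_integral_toReal_smul (measurable_weight ν) (by simp),
    ← integral_const_mul]
  refine integral_congr_ae ?_
  filter_upwards [ae_iota_mem] with z hz
  rw [toReal_weight hz, Complex.real_smul]
  push_cast
  ring

lemma integrable_iotaW_iff (G : ℂ → ℂ) :
    Integrable G (iotaW ν) ↔ Integrable (fun z => (1 - (‖z‖ : ℂ) ^ 2) ^ ν * G z) iota := by
  have h0 : ((ν : ℂ) - 1) ≠ 0 := by
    exact_mod_cast sub_ne_zero.2 (one_lt_cast (ν := ν)).ne'
  unfold iotaW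
  rw [integrable_withDensity_iff_integrable_smul' (measurable_weight ν) (by simp),
    ← integrable_const_mul_iff (isUnit_iff_ne_zero.2 h0) fun z => (1 - (‖z‖ : ℂ) ^ 2) ^ ν * G z]
  refine integrable_congr ?_
  filter_upwards [ae_iota_mem] with z hz
  rw [toReal_weight hz, Complex.real_smul]
  push_cast
  ring

omit [ν.AtLeastTwo] in
lemma isRotationInvariant_iotaW : IsRotationInvariant (iotaW ν) := by
  have h := (isRotationInvariant_volume_ball 1).withDensity_norm
    (ρ := fun r => ENNReal.ofReal (1 / (Real.pi * (1 - r ^ 2) ^ 2))) (by fun_prop)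
  exact h.withDensity_norm (ρ := fun r => ENNReal.ofReal (((ν : ℝ) - 1) * (1 - r ^ 2) ^ ν))
    (by fun_prop)

end WeightedMeasure

lemma integral_pow_mul_one_sub_pow (n m : ℕ) :
    ∫ x in (0 : ℝ)..1, x ^ n * (1 - x) ^ m =
      (n.factorial * m.factorial / (n + m + 1).factorial : ℝ) := by
  have h := Gamma_mul_Gamma_eq_betaIntegral (s := n + 1) (t := m + 1)
    (by norm_cast; positivity) (by norm_cast; positivity)
  rw [betaIntegral, show (n + 1 + (m + 1) : ℂ) = ((n + m + 1 : ℕ) : ℂ) + 1 by push_cast; ring,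
    Gamma_nat_eq_factorial, Gamma_nat_eq_factorial, Gamma_nat_eq_factorial] at h
  simp only [add_sub_cancel_right, cpow_natCast] at h
  norm_cast at h
  rw [intervalIntegral.integral_ofReal] at h
  rw [eq_div_iff (by positivity), mul_comm]
  exact_mod_cast h.symm

lemma integral_pow_mul_one_sub_sq_pow (n m : ℕ) :
    ∫ r in (0 : ℝ)..1, r ^ (2 * n + 1) * (1 - r ^ 2) ^ m =
      (n.factorial * m.factorial / (2 * (n + m + 1).factorial) : ℝ) := by
  have h := intervalIntegral.integral_comp_mul_deriv (a := 0) (b := 1) (f := fun r : ℝ => r ^ 2)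
    (f' := fun r => 2 * r) (g := fun x => x ^ n * (1 - x) ^ m)
    (fun r _ => by simpa using hasDerivAt_pow 2 r) (by fun_prop) (by fun_prop)
  simp only [Function.comp_def, zero_pow two_ne_zero, one_pow, integral_pow_mul_one_sub_pow] at h
  rw [mul_comm (2 : ℝ), ← div_div, ← h, ← intervalIntegral.integral_div]
  refine intervalIntegral.integral_congr fun r _ => ?_
  ring

/-- The squared norm `1 / C(ν + n - 1, n)` of the monomial `z ^ n` in the weighted Bergman space
of weight `ν`. -/
def monoNormSq (ν n : ℕ) : ℝ := ((ν.multichoose n : ℕ) : ℝ)⁻¹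

lemma integral_iotaW_eq_integral_volume (m : ℕ) (G : ℂ → ℝ) :
    ∫ z, G z ∂iotaW (m + 2) =
      (m + 1) / Real.pi * ∫ z in ball (0 : ℂ) 1, (1 - ‖z‖ ^ 2) ^ m * G z := by
  have hI (F : ℂ → ℝ) : ∫ z, F z ∂iota =
      ∫ z in ball (0 : ℂ) 1, 1 / (Real.pi * (1 - ‖z‖ ^ 2) ^ 2) * F z := by
    rw [iota, integral_withDensity_eq_integral_toReal_smul measurable_density (by simp)]
    refine integral_congr_ae ?_
    filter_upwards [ae_restrict_mem measurableSet_ball] with z hz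
    have := one_sub_norm_sq_pos hz
    rw [ENNReal.toReal_ofReal (by positivity), smul_eq_mul]
  unfold iotaW
  rw [integral_withDensity_eq_integral_toReal_smul (measurable_weight _) (by simp), hI,
    ← integral_const_mul]
  refine setIntegral_congr_fun measurableSet_ball fun z hz => ?_
  have h0 : 1 - ‖z‖ ^ 2 ≠ 0 := (one_sub_norm_sq_pos hz).ne'
  simp only [toReal_weight hz, smul_eq_mul]
  push_cast
  field_simp
  ring

lemma setIntegral_ball_norm (g : ℝ → ℝ) :
    ∫ z in ball (0 : ℂ) 1, g ‖z‖ = 2 * Real.pi * ∫ r in (0 : ℝ)..1, r * g r := by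
  have hind : (ball (0 : ℂ) 1).indicator (fun z => g ‖z‖) =
      fun z => (Set.Iio 1).indicator g ‖z‖ := by
    rw [show ball (0 : ℂ) 1 = norm ⁻¹' Set.Iio 1 by ext; simp]
    exact funext fun _ => Set.indicator_comp_right (norm : ℂ → ℝ)
  have hind' : (fun r : ℝ => r * (Set.Iio 1).indicator g r) =
      (Set.Iio 1).indicator fun r => r * g r := by
    ext r
    rw [Set.indicator_mul_right _ fun r : ℝ => r]
  rw [← integral_indicator measurableSet_ball, hind, integral_fun_norm_addHaar,
    finrank_real_complex]
  simp only [Nat.add_one_sub_one, pow_one, smul_eq_mul, hind']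
  rw [setIntegral_indicator measurableSet_Iio, Set.Ioi_inter_Iio, ← integral_Ioc_eq_integral_Ioo,
    ← intervalIntegral.integral_of_le zero_le_one, measureReal_def, volume_ball]
  simp [mul_assoc]

lemma integral_norm_pow_iotaW (ν n : ℕ) [ν.AtLeastTwo] :
    ∫ z, ‖z‖ ^ (2 * n) ∂iotaW ν = monoNormSq ν n := by
  obtain ⟨m, rfl⟩ := Nat.exists_eq_add_of_le' (Nat.AtLeastTwo.prop (n := ν))
  have hradial (r : ℝ) : r * ((1 - r ^ 2) ^ m * r ^ (2 * n)) =
      r ^ (2 * n + 1) * (1 - r ^ 2) ^ m := by ring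
  have hchoose : ((n + m + 1).choose n : ℝ) * n.factorial * (m + 1).factorial =
      (n + m + 1).factorial := by
    rw [add_assoc, Nat.choose_symm_add]
    exact_mod_cast Nat.add_choose_mul_factorial_mul_factorial n (m + 1)
  rw [integral_iotaW_eq_integral_volume,
    setIntegral_ball_norm fun r => (1 - r ^ 2) ^ m * r ^ (2 * n)]
  simp only [hradial]
  rw [integral_pow_mul_one_sub_sq_pow, monoNormSq, Nat.multichoose_eq,
    show m + 2 + n - 1 = n + m + 1 by omega, ← hchoose, Nat.factorial_succ m]
  have hpos : ((n + m + 1).choose n : ℝ) ≠ 0 := by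
    exact_mod_cast (Nat.choose_pos (by omega)).ne'
  push_cast
  field_simp

/-! ### Elements of the weighted Bergman spaces -/

section FunctionSpace

variable {ν : ℕ}

lemma H_ext {u v : H ν} (h : ∀ z : Disc, fn u z = fn v z) : u = v := by
  refine (toLp ν).injective (Lp.ext ?_)
  filter_upwards [toLp_ae_eq_fn u, toLp_ae_eq_fn v, ae_iotaW_mem ν] with z hu hv hz
  rw [hu, hv, h ⟨z, hz⟩]

lemma inner_eq_integral (u v : H ν) :
    inner ℂ u v = ∫ z, conj (fn u z) * fn v z ∂iotaW ν := by
  rw [← (toLp ν).inner_map_map, L2.inner_def]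
  refine integral_congr_ae ?_
  filter_upwards [toLp_ae_eq_fn u, toLp_ae_eq_fn v] with z hu hv
  rw [RCLike.inner_apply, hu, hv, mul_comm]

lemma integrable_fn (u : H ν) : Integrable (fn u) (iotaW ν) := by
  have := isFiniteMeasure_iotaW ν
  exact ((Lp.memLp (toLp ν u)).ae_eq (toLp_ae_eq_fn u)).integrable one_le_two

/-- The element of the weighted Bergman space given by a square integrable holomorphic function. -/
def ofMemLp {F : ℂ → ℂ} (hF : DifferentiableOn ℂ F (ball 0 1)) (hm : MemLp F 2 (iotaW ν)) : H ν :=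
  ⟨hm.toLp F, F, hF, hm.coeFn_toLp⟩

lemma toLp_ofMemLp {F : ℂ → ℂ} (hF : DifferentiableOn ℂ F (ball 0 1))
    (hm : MemLp F 2 (iotaW ν)) : toLp ν (ofMemLp hF hm) =ᵐ[iotaW ν] F :=
  hm.coeFn_toLp

variable [ν.AtLeastTwo]

lemma fn_eq_of_ae (u : H ν) {F : ℂ → ℂ} (hF : DifferentiableOn ℂ F (ball 0 1))
    (h : toLp ν u =ᵐ[iotaW ν] F) (z : Disc) : fn u z = F z := by
  have hbound := Lp_bound (Nat.AtLeastTwo.prop (n := ν)) (toLp ν u - toLp ν u)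
    ((differentiableOn_fn u).sub hF) ((Lp.coeFn_sub _ _).trans ((toLp_ae_eq_fn u).sub h)) z.2
  rw [sub_self, norm_zero, zero_pow two_ne_zero, mul_zero] at hbound
  have hsq : ‖(fn u - F) z‖ ^ 2 = 0 :=
    (nonpos_of_mul_nonpos_right hbound (pow_pos (one_sub_norm_sq_pos z.2) ν)).antisymm
      (sq_nonneg _)
  exact sub_eq_zero.1 (norm_eq_zero.1 (pow_eq_zero_iff two_ne_zero |>.1 hsq))

lemma fn_ofMemLp {F : ℂ → ℂ} (hF : DifferentiableOn ℂ F (ball 0 1)) (hm : MemLp F 2 (iotaW ν))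
    (z : Disc) : fn (ofMemLp hF hm) z = F z :=
  fn_eq_of_ae _ hF (toLp_ofMemLp hF hm) z

lemma norm_fn_le (u : H ν) (z : Disc) :
    ‖fn u z‖ ≤ √(4 ^ ν / (1 - ‖(z : ℂ)‖ ^ 2) ^ ν) * ‖u‖ := by
  have hbound := Lp_bound (Nat.AtLeastTwo.prop (n := ν)) (toLp ν u) (differentiableOn_fn u)
    (toLp_ae_eq_fn u) z.2
  rw [(toLp ν).norm_map] at hbound
  rw [← Real.sqrt_sq (norm_nonneg u), ← Real.sqrt_mul' _ (sq_nonneg _)]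
  refine Real.le_sqrt_of_sq_le ?_
  rwa [div_mul_eq_mul_div, le_div_iff₀ (pow_pos (one_sub_norm_sq_pos z.2) ν), mul_comm]

/-- Evaluation at a point of the disc, as a continuous linear functional. -/
def evalCLM (ν : ℕ) [ν.AtLeastTwo] (z : Disc) : H ν →L[ℂ] ℂ :=
  LinearMap.mkContinuous
    { toFun := fun u => fn u z
      map_add' := fun u v => by
        refine fn_eq_of_ae _ ((differentiableOn_fn u).add (differentiableOn_fn v)) ?_ z
        rw [map_add]
        exact (Lp.coeFn_add _ _).trans ((toLp_ae_eq_fn u).add (toLp_ae_eq_fn v))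
      map_smul' := fun c u => by
        refine fn_eq_of_ae _ ((differentiableOn_fn u).const_smul c) ?_ z
        rw [map_smul]
        exact (Lp.coeFn_smul _ _).trans ((toLp_ae_eq_fn u).const_smul c) }
    _ fun u => norm_fn_le u z

lemma evalCLM_apply (z : Disc) (u : H ν) : evalCLM ν z u = fn u z := rfl

end FunctionSpace

section PowKernel

/-- The centre of the disc. -/
def origin : Disc := ⟨0, mem_ball_self one_pos⟩

@[simp] lemma coe_origin : ((origin : Disc) : ℂ) = 0 := rfl

lemma norm_lt_one (z : Disc) : ‖(z : ℂ)‖ < 1 := mem_ball_zero_iff.1 z.2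

lemma one_sub_mul_conj_ne_zero (x y : Disc) : 1 - (x : ℂ) * conj (y : ℂ) ≠ 0 :=
  norm_pos_iff.1 ((sub_pos.2 (norm_lt_one y)).trans_le (norm_one_sub_ge y x.2))

lemma differentiableOn_pow_mul_kernel (j m : ℕ) (y : Disc) :
    DifferentiableOn ℂ (fun x : ℂ => x ^ j * ((1 - x * conj (y : ℂ)) ^ m)⁻¹) (ball 0 1) :=
  (differentiable_pow j).differentiableOn.mul (differentiableOn_kernel m y)

lemma memLp_pow_mul_kernel (ν j m : ℕ) (y : Disc) :
    MemLp (fun x : ℂ => x ^ j * ((1 - x * conj (y : ℂ)) ^ m)⁻¹) 2 (iotaW ν) := by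
  have := isFiniteMeasure_iotaW ν
  refine MemLp.of_bound (by fun_prop) (((1 - ‖(y : ℂ)‖) ^ m)⁻¹) ?_
  filter_upwards [ae_iotaW_mem ν] with x hx
  have hy : 0 < 1 - ‖(y : ℂ)‖ := sub_pos.2 (norm_lt_one y)
  have hxj : ‖x‖ ^ j ≤ 1 := pow_le_one₀ (norm_nonneg x) (mem_ball_zero_iff.1 hx).le
  rw [norm_mul, norm_inv, norm_pow, norm_pow]
  refine (mul_le_of_le_one_left (by positivity) hxj).trans ?_
  gcongr
  exact norm_one_sub_ge y hx

/-- The function `x ↦ x ^ j * (1 - x * conj y) ^ (-m)` as an element of the weighted Bergman space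
of weight `ν`. -/
def powKernel (ν j m : ℕ) (y : Disc) : H ν :=
  ofMemLp (differentiableOn_pow_mul_kernel j m y) (memLp_pow_mul_kernel ν j m y)

/-- The monomial `x ↦ x ^ n` as an element of the weighted Bergman space of weight `ν`. -/
def mono (ν n : ℕ) : H ν := powKernel ν n 0 origin

variable {ν : ℕ} [ν.AtLeastTwo]

lemma fn_powKernel (j m : ℕ) (x y : Disc) :
    fn (powKernel ν j m y) x = (x : ℂ) ^ j * ((1 - (x : ℂ) * conj (y : ℂ)) ^ m)⁻¹ :=
  fn_ofMemLp (differentiableOn_pow_mul_kernel j m y) _ x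

lemma fn_kernel (x y : Disc) : fn (kernel ν y) x = ((1 - (x : ℂ) * conj (y : ℂ)) ^ ν)⁻¹ :=
  fn_ofMemLp (differentiableOn_kernel ν y) (memLp_kernel ν y) x

lemma fn_mono (n : ℕ) (x : Disc) : fn (mono ν n) x = (x : ℂ) ^ n := by
  simp [mono, fn_powKernel]

lemma powKernel_zero_eq_kernel (y : Disc) : powKernel ν 0 ν y = kernel ν y :=
  H_ext fun x => by rw [fn_powKernel, fn_kernel, pow_zero, one_mul]

lemma powKernel_origin (j m : ℕ) : powKernel ν j m origin = mono ν j :=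
  H_ext fun x => by simp [fn_powKernel, fn_mono]

lemma kernel_origin : kernel ν origin = mono ν 0 := by
  rw [← powKernel_zero_eq_kernel, powKernel_origin]

end PowKernel

/-! ### The reproducing property -/

section Reproducing

lemma taylorCoeff_pow (k n : ℕ) : taylorCoeff (fun z => z ^ k) n = if n = k then 1 else 0 := by
  rw [taylorCoeff, iteratedDeriv_fun_pow_zero]
  split_ifs with h <;> simp [h, Nat.factorial_ne_zero]

lemma taylorCoeff_congr {F G : ℂ → ℂ} (h : ∀ z : Disc, F z = G z) (n : ℕ) :
    taylorCoeff F n = taylorCoeff G n := by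
  have hFG : F =ᶠ[nhds 0] G := by
    filter_upwards [ball_mem_nhds (0 : ℂ) one_pos] with z hz using h ⟨z, hz⟩
  rw [taylorCoeff, hFG.iteratedDeriv_eq, taylorCoeff]

lemma hasSum_multichoose_mul_pow (m : ℕ) {w : ℂ} (hw : ‖w‖ < 1) :
    HasSum (fun n => (m.multichoose n : ℂ) * w ^ n) ((1 - w) ^ m)⁻¹ := by
  cases m with
  | zero =>
    convert hasSum_single (f := fun n => (Nat.multichoose 0 n : ℂ) * w ^ n) 0 fun n hn => ?_
    · simp
    · obtain ⟨n, rfl⟩ := Nat.exists_eq_succ_of_ne_zero hn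
      simp
  | succ m =>
    rw [← one_div]
    refine (hasSum_choose_mul_geometric_of_norm_lt_one m hw).congr_fun fun n => ?_
    rw [Nat.multichoose_eq, show m + 1 + n - 1 = n + m by omega, Nat.choose_symm_add]

variable {ν : ℕ} [ν.AtLeastTwo]

lemma monoNormSq_pos (n : ℕ) : 0 < monoNormSq ν n := by
  have := Nat.AtLeastTwo.prop (n := ν)
  rw [monoNormSq, Nat.multichoose_eq]
  exact inv_pos.2 (Nat.cast_pos.2 (Nat.choose_pos (by omega)))

lemma monoNormSq_le_one (n : ℕ) : monoNormSq ν n ≤ 1 :=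
  inv_le_one_of_one_le₀ (Nat.one_le_cast.2 (Nat.cast_pos.1 (inv_pos.1 (monoNormSq_pos n))))

lemma inner_mono (n : ℕ) (u : H ν) :
    inner ℂ (mono ν n) u = monoNormSq ν n * taylorCoeff (fn u) n := by
  have := isFiniteMeasure_iotaW ν
  rw [← integral_norm_pow_iotaW, ← (isRotationInvariant_iotaW ν).integral_conj_pow_mul
    (ae_iotaW_mem ν) (differentiableOn_fn u), inner_eq_integral]
  · refine integral_congr_ae ?_
    filter_upwards [ae_iotaW_mem ν] with z hz
    rw [fn_mono n ⟨z, hz⟩, map_pow]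
  · refine (integrable_fn u).bdd_mul (c := 1) (by fun_prop) ?_
    filter_upwards [ae_iotaW_mem ν] with z hz
    rw [norm_pow, RCLike.norm_conj]
    exact pow_le_one₀ (norm_nonneg z) (mem_ball_zero_iff.1 hz).le

lemma inner_mono_mono (i j : ℕ) :
    inner ℂ (mono ν i) (mono ν j) = if i = j then (monoNormSq ν i : ℂ) else 0 := by
  rw [inner_mono, taylorCoeff_congr (G := fun z => z ^ j) (fn_mono j),
    taylorCoeff_pow, mul_ite, mul_one, mul_zero]

lemma norm_mono_le_one (n : ℕ) : ‖mono ν n‖ ≤ 1 := by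
  have h := inner_self_eq_norm_sq_to_K (𝕜 := ℂ) (mono ν n)
  rw [inner_mono_mono, if_pos rfl] at h
  have hsq : ‖mono ν n‖ ^ 2 = monoNormSq ν n := by
    exact ofReal_injective ((ofReal_pow _ _).trans h.symm)
  exact (sq_le_one_iff₀ (norm_nonneg _)).1 (hsq.trans_le (monoNormSq_le_one n))

lemma hasSum_powKernel (j m : ℕ) (z : Disc) :
    HasSum (fun n => ((m.multichoose n : ℂ) * conj (z : ℂ) ^ n) • mono ν (j + n))
      (powKernel ν j m z) := by
  have hz : ‖conj (z : ℂ)‖ < 1 := (RCLike.norm_conj _).trans_lt (norm_lt_one z)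
  have hsummable : Summable fun n =>
      ((m.multichoose n : ℂ) * conj (z : ℂ) ^ n) • mono ν (j + n) :=
    .of_norm_bounded (hasSum_multichoose_mul_pow m hz).summable.norm fun n => by
      rw [norm_smul]
      exact mul_le_of_le_one_right (norm_nonneg _) (norm_mono_le_one _)
  convert hsummable.hasSum
  refine H_ext fun x => ?_
  have hx : ‖(x : ℂ) * conj (z : ℂ)‖ < 1 := by
    rw [norm_mul]
    exact mul_lt_one_of_nonneg_of_lt_one_left (norm_nonneg _) (norm_lt_one x) hz.le
  have hseries := (hasSum_multichoose_mul_pow m hx).mul_left ((x : ℂ) ^ j)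
  rw [fn_powKernel, ← evalCLM_apply]
  refine hseries.unique ((hsummable.hasSum.mapL (evalCLM ν x)).congr_fun fun n => ?_)
  rw [map_smul, evalCLM_apply, fn_mono, smul_eq_mul]
  ring

lemma hasSum_inner_powKernel (j m : ℕ) (z : Disc) (u : H ν) :
    HasSum (fun n => (m.multichoose n : ℂ) * (z : ℂ) ^ n * inner ℂ (mono ν (j + n)) u)
      (inner ℂ (powKernel ν j m z) u) := by
  refine ((hasSum_powKernel j m z).mapL (innerSLFlip ℂ u)).congr_fun fun n => ?_
  rw [innerSLFlip_apply_apply, inner_smul_left, map_mul, map_pow, conj_conj, conj_natCast]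

lemma monoNormSq_mul_multichoose (n : ℕ) : monoNormSq ν n * ν.multichoose n = 1 :=
  inv_mul_cancel₀ (inv_pos.1 (monoNormSq_pos n)).ne'

lemma inner_kernel (z : Disc) (u : H ν) : inner ℂ (kernel ν z) u = fn u z := by
  have hsum := hasSum_inner_powKernel 0 ν z u
  rw [powKernel_zero_eq_kernel] at hsum
  refine hsum.unique ((hasSum_taylorCoeff_mul_pow (differentiableOn_fn u) z.2).congr_fun
    fun n => ?_)
  have hcoeff : (monoNormSq ν n : ℂ) * ν.multichoose n = 1 := by
    exact_mod_cast monoNormSq_mul_multichoose n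
  rw [zero_add, inner_mono]
  linear_combination (z : ℂ) ^ n * taylorCoeff (fn u) n * hcoeff

lemma inner_kernel_kernel (x y : Disc) :
    inner ℂ (kernel ν x) (kernel ν y) = ((1 - (x : ℂ) * conj (y : ℂ)) ^ ν)⁻¹ := by
  rw [inner_kernel, fn_kernel]

lemma eq_zero_of_inner_kernel {u : H ν} (h : ∀ z, inner ℂ (kernel ν z) u = 0) : u = 0 :=
  H_ext fun z => by rw [← inner_kernel, h, ← inner_kernel, inner_zero_right]

lemma eq_zero_of_inner_mono {u : H ν} (h : ∀ n, inner ℂ (mono ν n) u = 0) : u = 0 :=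
  eq_zero_of_inner_kernel fun z => by
    rw [← powKernel_zero_eq_kernel, ← (hasSum_inner_powKernel 0 ν z u).tsum_eq]
    simp only [h, mul_zero, tsum_zero]

end Reproducing

/-! ### Isometries from Gram matrices -/

section Gram

variable {𝕜 E F ι : Type*} [RCLike 𝕜] [NormedAddCommGroup E] [InnerProductSpace 𝕜 E]
  [NormedAddCommGroup F] [InnerProductSpace 𝕜 F]

lemma dense_span_of_forall_inner_eq_zero [CompleteSpace E] {a : ι → E}
    (h : ∀ u : E, (∀ i, inner 𝕜 (a i) u = 0) → u = 0) :
    Dense (Submodule.span 𝕜 (Set.range a) : Set E) := by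
  rw [Submodule.dense_iff_topologicalClosure_eq_top, Submodule.topologicalClosure_eq_top_iff,
    eq_bot_iff]
  exact fun u hu => h u fun i => hu _ (Submodule.subset_span ⟨i, rfl⟩)

lemma norm_linearCombination_eq_of_gram {a : ι → E} {b : ι → F}
    (h : ∀ i j, inner 𝕜 (a i) (a j) = inner 𝕜 (b i) (b j)) (c : ι →₀ 𝕜) :
    ‖Finsupp.linearCombination 𝕜 b c‖ = ‖Finsupp.linearCombination 𝕜 a c‖ := by
  rw [@norm_eq_sqrt_re_inner 𝕜 F, @norm_eq_sqrt_re_inner 𝕜 E]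
  simp only [Finsupp.linearCombination_apply, Finsupp.sum, sum_inner, inner_sum,
    inner_smul_left, inner_smul_right, h]

lemma exists_linearIsometry_of_gram [CompleteSpace F] {a : ι → E} {b : ι → F}
    (ha : Dense (Submodule.span 𝕜 (Set.range a) : Set E))
    (h : ∀ i j, inner 𝕜 (a i) (a j) = inner 𝕜 (b i) (b j)) :
    ∃ V : E →ₗᵢ[𝕜] F, ∀ i, V (a i) = b i := by
  set e := Finsupp.linearCombination 𝕜 a with he
  set f := Finsupp.linearCombination 𝕜 b with hf
  have hdense : DenseRange e := by
    rwa [← Finsupp.range_linearCombination] at ha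
  have hnorm (c) : ‖f c‖ = ‖e c‖ := norm_linearCombination_eq_of_gram h c
  have hV (c) : f.extendOfNorm e (e c) = f c :=
    LinearMap.extendOfNorm_eq hdense ⟨1, fun c => by rw [hnorm, one_mul]⟩ c
  refine ⟨⟨(f.extendOfNorm e).toLinearMap, fun x => ?_⟩, fun i => ?_⟩
  · refine hdense.induction_on (p := fun x => ‖f.extendOfNorm e x‖ = ‖x‖) x
      (isClosed_eq (by fun_prop) (by fun_prop)) fun c => ?_
    rw [hV, hnorm]
  · have hVi := hV (Finsupp.single i 1)
    rwa [he, hf, Finsupp.linearCombination_single, Finsupp.linearCombination_single, one_smul,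
      one_smul] at hVi

end Gram

section DenseSpan

variable (ν : ℕ) [ν.AtLeastTwo]

lemma dense_span_kernel : Dense (Submodule.span ℂ (Set.range (kernel ν)) : Set (H ν)) :=
  dense_span_of_forall_inner_eq_zero fun _ => eq_zero_of_inner_kernel

lemma dense_span_mono : Dense (Submodule.span ℂ (Set.range (mono ν)) : Set (H ν)) :=
  dense_span_of_forall_inner_eq_zero fun _ => eq_zero_of_inner_mono

end DenseSpan

/-! ### The unitary action of `SU(1,1)` -/

/-- The element of `SU(1,1)` with first row `(a, b)`; its second row is `(conj b, conj a)`. -/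
@[ext]
structure SU where
  a : ℂ
  b : ℂ
  norm_sq_sub_norm_sq : ‖a‖ ^ 2 - ‖b‖ ^ 2 = 1

section Moebius

instance : InvolutiveInv SU where
  inv g := ⟨conj g.a, -g.b, by
    rw [RCLike.norm_conj, norm_neg, g.norm_sq_sub_norm_sq]⟩
  inv_inv g := SU.ext (conj_conj _) (neg_neg _)

@[simp] lemma SU.inv_a (g : SU) : g⁻¹.a = conj g.a := rfl

@[simp] lemma SU.inv_b (g : SU) : g⁻¹.b = -g.b := rfl

variable (g : SU)

lemma SU.mul_conj_sub_mul_conj : g.a * conj g.a - g.b * conj g.b = 1 := by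
  rw [mul_conj', mul_conj']
  exact_mod_cast g.norm_sq_sub_norm_sq

lemma SU.denom_mul_conj_sub (x y : ℂ) :
    (g.a + g.b * x) * conj (g.a + g.b * y) -
      (conj g.a * x + conj g.b) * conj (conj g.a * y + conj g.b) = 1 - x * conj y := by
  simp only [map_add, map_mul, conj_conj]
  linear_combination (1 - x * conj y) * g.mul_conj_sub_mul_conj

lemma SU.norm_num_lt_norm_denom (x : Disc) :
    ‖conj g.a * (x : ℂ) + conj g.b‖ < ‖g.a + g.b * (x : ℂ)‖ := by
  have h := g.denom_mul_conj_sub x x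
  rw [mul_conj', mul_conj', mul_conj'] at h
  have hsq : ‖g.a + g.b * (x : ℂ)‖ ^ 2 - ‖conj g.a * (x : ℂ) + conj g.b‖ ^ 2 =
      1 - ‖(x : ℂ)‖ ^ 2 := by exact_mod_cast h
  have hx := one_sub_norm_sq_pos x.2
  exact lt_of_pow_lt_pow_left₀ 2 (norm_nonneg _) (by linarith)

lemma SU.denom_ne_zero (x : Disc) : g.a + g.b * (x : ℂ) ≠ 0 :=
  norm_pos_iff.1 ((norm_nonneg _).trans_lt (g.norm_num_lt_norm_denom x))

/-- The Möbius transformation `x ↦ (conj a * x + conj b) / (a + b * x)` of the disc. It is inverse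
to the one in the formula for the action of `g`, so that `g` maps `K_x` to a multiple of
`K_{moebius g x}`. -/
def moebius (x : Disc) : Disc :=
  ⟨(conj g.a * x + conj g.b) / (g.a + g.b * x), by
    rw [mem_ball_zero_iff, norm_div, div_lt_one (norm_pos_iff.2 (g.denom_ne_zero x))]
    exact g.norm_num_lt_norm_denom x⟩

lemma coe_moebius (x : Disc) :
    (moebius g x : ℂ) = (conj g.a * x + conj g.b) / (g.a + g.b * x) := rfl

lemma denom_mul_one_sub_moebius (x y : Disc) :
    (g.a + g.b * x) * conj (g.a + g.b * (y : ℂ)) *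
      (1 - (moebius g x : ℂ) * conj (moebius g y : ℂ)) = 1 - (x : ℂ) * conj (y : ℂ) := by
  have hx := g.denom_ne_zero x
  have hy : conj (g.a + g.b * (y : ℂ)) ≠ 0 := (map_ne_zero _).2 (g.denom_ne_zero y)
  rw [← g.denom_mul_conj_sub x, coe_moebius, coe_moebius, map_div₀]
  field_simp

lemma denom_inv_moebius_mul (x : Disc) :
    (g⁻¹.a + g⁻¹.b * (moebius g x : ℂ)) * (g.a + g.b * x) = 1 := by
  have hx := g.denom_ne_zero x
  rw [coe_moebius, SU.inv_a, SU.inv_b]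
  field_simp
  linear_combination g.mul_conj_sub_mul_conj

lemma moebius_inv_moebius (x : Disc) : moebius g⁻¹ (moebius g x) = x := by
  have hx := g.denom_ne_zero x
  refine Subtype.ext ?_
  rw [coe_moebius g⁻¹, div_eq_iff (g⁻¹.denom_ne_zero _), ← mul_left_inj' hx, mul_assoc,
    denom_inv_moebius_mul, coe_moebius, SU.inv_a, SU.inv_b, conj_conj, map_neg, add_mul, mul_assoc,
    div_mul_cancel₀ _ hx]
  linear_combination (x : ℂ) * g.mul_conj_sub_mul_conj

end Moebius

section Action

variable (ν : ℕ) [ν.AtLeastTwo] (g : SU)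

lemma exists_linearIsometry_kernel : ∃ U : H ν →ₗᵢ[ℂ] H ν, ∀ x : Disc,
    U (kernel ν x) = (conj (g.a + g.b * (x : ℂ)) ^ ν)⁻¹ • kernel ν (moebius g x) := by
  refine exists_linearIsometry_of_gram (dense_span_kernel ν) fun x y => ?_
  rw [inner_smul_left, inner_smul_right, inner_kernel_kernel, inner_kernel_kernel,
    ← denom_mul_one_sub_moebius g]
  simp only [map_inv₀, map_pow, conj_conj, mul_pow, mul_inv]
  ring

/-- The unitary action of `SU(1,1)` on the weighted Bergman space of weight `ν`, constructed from
its values on the kernels. -/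
def action : H ν →ₗᵢ[ℂ] H ν := (exists_linearIsometry_kernel ν g).choose

variable {ν}

lemma action_kernel (x : Disc) :
    action ν g (kernel ν x) = (conj (g.a + g.b * (x : ℂ)) ^ ν)⁻¹ • kernel ν (moebius g x) :=
  (exists_linearIsometry_kernel ν g).choose_spec x

lemma action_inv_action (u : H ν) : action ν g⁻¹ (action ν g u) = u := by
  have h : (action ν g⁻¹).toContinuousLinearMap ∘L (action ν g).toContinuousLinearMap =
      ContinuousLinearMap.id ℂ (H ν) := by
    refine ContinuousLinearMap.ext_on (dense_span_kernel ν) ?_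
    rintro _ ⟨x, rfl⟩
    simp only [ContinuousLinearMap.comp_apply, LinearIsometry.coe_toContinuousLinearMap,
      ContinuousLinearMap.id_apply, action_kernel, map_smul, moebius_inv_moebius, smul_smul]
    rw [← mul_inv, ← mul_pow, ← map_mul, mul_comm (g.a + g.b * _), denom_inv_moebius_mul]
    simp
  exact congrArg (fun T : H ν →L[ℂ] H ν => T u) h

lemma inner_action_left (u v : H ν) :
    inner ℂ (action ν g u) v = inner ℂ u (action ν g⁻¹ v) := by
  rw [← (action ν g⁻¹).inner_map_map, action_inv_action]

lemma inner_action_right (u v : H ν) :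
    inner ℂ u (action ν g v) = inner ℂ (action ν g⁻¹ u) v := by
  rw [← inner_conj_symm, inner_action_left, inner_conj_symm]

lemma fn_action (u : H ν) (z : Disc) : fn (action ν g u) z = act ν g.a g.b (fn u) z := by
  rw [← inner_kernel, inner_action_right, action_kernel, inner_smul_left, inner_kernel, act,
    coe_moebius, SU.inv_a, SU.inv_b]
  simp only [map_inv₀, map_pow, conj_conj, map_neg]
  rw [add_comm (conj g.a), sub_eq_add_neg]

end Action

/-! ### The Hilbert space tensor product -/

section Tensor

variable {μ ν : ℕ}

lemma inner_tmul (u u' : H μ) (v v' : H ν) :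
    inner ℂ (tmul u v) (tmul u' v') = inner ℂ u u' * inner ℂ v v' :=
  (UniformSpace.Completion.inner_coe (𝕜 := ℂ) (E := H μ ⊗[ℂ] H ν) _ _).trans
    (TensorProduct.inner_tmul ..)

variable (μ ν) in
/-- The bilinear map `(u, v) ↦ u ⊗ v`. -/
def tmulL : H μ →L[ℂ] H ν →L[ℂ] HTensor μ ν :=
  (ContinuousLinearMap.compL ℂ (H ν) (H μ ⊗[ℂ] H ν) (HTensor μ ν)
    (UniformSpace.Completion.toComplL (𝕜 := ℂ) (E := H μ ⊗[ℂ] H ν))).comp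
      (TensorProduct.mkL ℂ (H μ) (H ν))

lemma tmulL_apply (u : H μ) (v : H ν) : tmulL μ ν u v = tmul u v := rfl

lemma tmul_smul_smul (c d : ℂ) (u : H μ) (v : H ν) :
    tmul (c • u) (d • v) = (c * d) • tmul u v := by
  rw [← tmulL_apply, ← tmulL_apply, map_smul, map_smul, _root_.smul_apply, smul_smul, mul_comm]

lemma ext_tmul {E : Type*} [NormedAddCommGroup E] [NormedSpace ℂ E]
    {S T : HTensor μ ν →L[ℂ] E} (h : ∀ u v, S (tmul u v) = T (tmul u v)) : S = T := by
  let ι : H μ ⊗[ℂ] H ν →L[ℂ] HTensor μ ν :=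
    UniformSpace.Completion.toComplL (𝕜 := ℂ) (E := H μ ⊗[ℂ] H ν)
  have hι : (S ∘L ι).toLinearMap = (T ∘L ι).toLinearMap := TensorProduct.ext' h
  ext s
  exact UniformSpace.Completion.induction_on (p := fun s : HTensor μ ν => S s = T s) s
    (isClosed_eq (by fun_prop) (by fun_prop)) (DFunLike.congr_fun hι)

lemma eq_of_inner_tmul_of_dense {ι κ : Type*} {e : ι → H μ} {d : κ → H ν}
    (he : Dense (Submodule.span ℂ (Set.range e) : Set (H μ)))
    (hd : Dense (Submodule.span ℂ (Set.range d) : Set (H ν))) {s t : HTensor μ ν}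
    (h : ∀ i j, inner ℂ (tmul (e i) (d j)) s = inner ℂ (tmul (e i) (d j)) t) : s = t := by
  have hconj (i j) : innerSL ℂ s (tmul (e i) (d j)) = innerSL ℂ t (tmul (e i) (d j)) := by
    rw [innerSL_apply_apply, innerSL_apply_apply, ← inner_conj_symm, h, inner_conj_symm]
  have hleft (j u) : innerSL ℂ s (tmul u (d j)) = innerSL ℂ t (tmul u (d j)) :=
    DFunLike.congr_fun (ContinuousLinearMap.ext_on he (f := innerSL ℂ s ∘L (tmulL μ ν).flip (d j))
      (g := innerSL ℂ t ∘L (tmulL μ ν).flip (d j)) (Set.forall_mem_range.2 (hconj · j))) u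
  have hright (u v) : innerSL ℂ s (tmul u v) = innerSL ℂ t (tmul u v) :=
    DFunLike.congr_fun (ContinuousLinearMap.ext_on hd (f := innerSL ℂ s ∘L tmulL μ ν u)
      (g := innerSL ℂ t ∘L tmulL μ ν u) (Set.forall_mem_range.2 (hleft · u))) v
  exact ext_inner_right ℂ (DFunLike.congr_fun (ext_tmul hright))

/-- The operator `A ⊗ B`. -/
def tensorMap (A : H μ →L[ℂ] H μ) (B : H ν →L[ℂ] H ν) : HTensor μ ν →L[ℂ] HTensor μ ν :=
  (TensorProduct.mapL A B).completion

lemma tensorMap_tmul (A : H μ →L[ℂ] H μ) (B : H ν →L[ℂ] H ν) (u : H μ) (v : H ν) :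
    tensorMap A B (tmul u v) = tmul (A u) (B v) :=
  ContinuousLinearMap.completion_apply_coe _ _

variable [μ.AtLeastTwo] [ν.AtLeastTwo]

lemma eq_of_inner_kernel_tmul {s t : HTensor μ ν}
    (h : ∀ x y, inner ℂ (tmul (kernel μ x) (kernel ν y)) s =
      inner ℂ (tmul (kernel μ x) (kernel ν y)) t) : s = t :=
  eq_of_inner_tmul_of_dense (dense_span_kernel μ) (dense_span_kernel ν) h

lemma eq_of_inner_mono_tmul {s t : HTensor μ ν}
    (h : ∀ i j, inner ℂ (tmul (mono μ i) (mono ν j)) s =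
      inner ℂ (tmul (mono μ i) (mono ν j)) t) : s = t :=
  eq_of_inner_tmul_of_dense (dense_span_mono μ) (dense_span_mono ν) h

variable (μ ν) in
/-- The diagonal action of `SU(1,1)` on the Hilbert space tensor product. -/
def tensorAction (g : SU) : HTensor μ ν →L[ℂ] HTensor μ ν :=
  tensorMap (action μ g).toContinuousLinearMap (action ν g).toContinuousLinearMap

variable (g : SU)

lemma tensorAction_tmul (u : H μ) (v : H ν) :
    tensorAction μ ν g (tmul u v) = tmul (action μ g u) (action ν g v) :=
  tensorMap_tmul _ _ _ _

lemma adjoint_tensorAction :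
    ContinuousLinearMap.adjoint (tensorAction μ ν g) = tensorAction μ ν g⁻¹ := by
  refine ext_tmul fun u v => eq_of_inner_kernel_tmul fun x y => ?_
  rw [ContinuousLinearMap.adjoint_inner_right, tensorAction_tmul, tensorAction_tmul, inner_tmul,
    inner_tmul, inner_action_left, inner_action_left]

lemma inner_tensorAction_right (s t : HTensor μ ν) :
    inner ℂ s (tensorAction μ ν g t) = inner ℂ (tensorAction μ ν g⁻¹ s) t := by
  rw [← adjoint_tensorAction, ContinuousLinearMap.adjoint_inner_left]

end Tensor

/-! ### Binomial sums -/

section Binomial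

variable {μ ν k i j : ℕ}

lemma poch_natCast (ν k : ℕ) : poch ν k = k.factorial * (ν.multichoose k : ℝ) := by
  rw [poch, ascPochhammer_nat_eq_natCast_ascFactorial, Nat.ascFactorial_eq_factorial_mul_choose',
    Nat.multichoose_eq, Nat.cast_mul]

lemma multichoose_cast_pos [ν.AtLeastTwo] (k : ℕ) : (0 : ℝ) < ν.multichoose k :=
  inv_pos.1 (monoNormSq_pos k)

lemma choose_mul_monoNormSq [ν.AtLeastTwo] (hi : i ≤ k) :
    (k.choose i : ℝ) * monoNormSq ν (k - i) = (ν + k - 1).choose i * monoNormSq ν k := by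
  have hν : 2 ≤ ν := Nat.AtLeastTwo.prop
  have h := Nat.choose_mul (n := ν + k - 1) hi
  rw [show ν + k - 1 - i = ν + (k - i) - 1 by lia, ← Nat.multichoose_eq, ← Nat.multichoose_eq] at h
  have h₁ := multichoose_cast_pos (ν := ν) k
  have h₂ := multichoose_cast_pos (ν := ν) (k - i)
  rw [monoNormSq, monoNormSq, ← div_eq_mul_inv, ← div_eq_mul_inv, div_eq_div_iff h₂.ne' h₁.ne',
    mul_comm]
  exact_mod_cast h

lemma sum_choose_mul_choose_sub (m n k : ℕ) :
    ∑ i ∈ Finset.range (k + 1), m.choose i * n.choose (k - i) = (m + n).choose k := by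
  rw [Nat.add_choose_eq, Finset.Nat.sum_antidiagonal_eq_sum_range_succ
    fun i j => m.choose i * n.choose j]

lemma choose_mul_choose_eq_choose_mul_choose_sub (hi : i ≤ k) :
    k.choose i * i.choose j = k.choose j * (k - j).choose (k - i) := by
  rcases le_or_gt j i with hji | hij
  · rw [Nat.choose_mul hji, ← Nat.choose_symm (Nat.sub_le_sub_right hi j)]
    congr 2
    lia
  · rcases le_or_gt j k with hjk | hkj
    · rw [Nat.choose_eq_zero_of_lt hij, Nat.choose_eq_zero_of_lt (show k - j < k - i by lia),
        mul_zero, mul_zero]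
    · rw [Nat.choose_eq_zero_of_lt hij, Nat.choose_eq_zero_of_lt hkj, mul_zero, zero_mul]

lemma sum_range_choose_mul_of_le {R : Type*} [Semiring R] {p : ℕ} (hp : p ≤ k) (f : ℕ → R) :
    ∑ m ∈ Finset.range (p + 1), p.choose m * f m =
      ∑ m ∈ Finset.range (k + 1), p.choose m * f m := by
  refine Finset.sum_subset (Finset.range_subset_range.2 (by lia)) fun m _ hm => ?_
  rw [Nat.choose_eq_zero_of_lt (by simpa [Nat.lt_succ_iff] using hm), Nat.cast_zero, zero_mul]

lemma sum_mul_pow_mul_pow_of_sum_mul_choose_eq_zero {R : Type*} [CommRing R] {c : ℕ → R}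
    (hc : ∀ i < k, ∑ p ∈ Finset.range (k + 1), c p * p.choose i = 0) (x y : R) :
    ∑ p ∈ Finset.range (k + 1), c p * (x ^ p * y ^ (k - p)) = c k * (x - y) ^ k := by
  have hexpand {p : ℕ} (hp : p ≤ k) : x ^ p * y ^ (k - p) =
      ∑ m ∈ Finset.range (k + 1), p.choose m * ((x - y) ^ m * y ^ (k - m)) := by
    rw [← sum_range_choose_mul_of_le hp, show x ^ p = (x - y + y) ^ p by ring, add_pow,
      Finset.sum_mul]
    refine Finset.sum_congr rfl fun m hm => ?_
    have hm : m ≤ p := Finset.mem_range_succ_iff.1 hm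
    rw [show k - m = (p - m) + (k - p) by lia, pow_add]
    ring
  calc ∑ p ∈ Finset.range (k + 1), c p * (x ^ p * y ^ (k - p))
      = ∑ p ∈ Finset.range (k + 1), ∑ m ∈ Finset.range (k + 1),
          c p * p.choose m * ((x - y) ^ m * y ^ (k - m)) := by
        refine Finset.sum_congr rfl fun p hp => ?_
        rw [hexpand (Finset.mem_range_succ_iff.1 hp), Finset.mul_sum]
        exact Finset.sum_congr rfl fun m _ => by ring
    _ = ∑ m ∈ Finset.range (k + 1),
          (∑ p ∈ Finset.range (k + 1), c p * p.choose m) * ((x - y) ^ m * y ^ (k - m)) := by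
        rw [Finset.sum_comm]
        simp only [Finset.sum_mul]
    _ = (∑ p ∈ Finset.range (k + 1), c p * p.choose k) * ((x - y) ^ k * y ^ (k - k)) :=
        Finset.sum_eq_single_of_mem k (Finset.self_mem_range_succ k) fun m hm hmk => by
          rw [hc m (lt_of_le_of_ne (Finset.mem_range_succ_iff.1 hm) hmk), zero_mul]
    _ = c k * (x - y) ^ k := by
        rw [Finset.sum_eq_single_of_mem k (Finset.self_mem_range_succ k) fun p hp hpk => ?_]
        · simp
        · rw [Nat.choose_eq_zero_of_lt (lt_of_le_of_ne (Finset.mem_range_succ_iff.1 hp) hpk),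
            Nat.cast_zero, mul_zero]

lemma multichoose_add_mul_monoNormSq [ν.AtLeastTwo] (i n : ℕ) :
    ((ν + i).multichoose n : ℝ) * monoNormSq ν (i + n) = (i + n).choose i * monoNormSq ν i := by
  have : 2 ≤ ν := Nat.AtLeastTwo.prop
  have h := Nat.choose_mul (n := ν + i + n - 1) (Nat.le_add_left n i)
  rw [Nat.add_sub_cancel, show ν + i + n - 1 - n = ν + i - 1 by lia, ← Nat.multichoose_eq,
    ← Nat.multichoose_eq, show ν + i + n - 1 = ν + (i + n) - 1 by lia, ← Nat.multichoose_eq,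
    ← Nat.choose_symm_add] at h
  have h₁ := multichoose_cast_pos (ν := ν) i
  have h₂ := multichoose_cast_pos (ν := ν) (i + n)
  rw [monoNormSq, monoNormSq, ← div_eq_mul_inv, ← div_eq_mul_inv, div_eq_div_iff h₂.ne' h₁.ne',
    mul_comm ((i + n).choose i : ℝ)]
  exact_mod_cast h.symm

/-- The squared norm of `(x - y)^k` in the tensor product of the Bergman spaces of weights `μ`
and `ν`. -/
def lowestNormSq (μ ν k : ℕ) : ℝ :=
  ∑ i ∈ Finset.range (k + 1), (k.choose i : ℝ) ^ 2 * (monoNormSq μ i * monoNormSq ν (k - i))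

lemma lowestNormSq_eq [μ.AtLeastTwo] [ν.AtLeastTwo] (k : ℕ) :
    lowestNormSq μ ν k =
      (μ + ν + k - 1).multichoose k * (monoNormSq μ k * monoNormSq ν k) := by
  have hμ : 2 ≤ μ := Nat.AtLeastTwo.prop
  have hν : 2 ≤ ν := Nat.AtLeastTwo.prop
  rw [lowestNormSq, Nat.multichoose_eq,
    show μ + ν + k - 1 + k - 1 = (ν + k - 1) + (μ + k - 1) by lia, ← sum_choose_mul_choose_sub,
    Nat.cast_sum, Finset.sum_mul]
  refine Finset.sum_congr rfl fun i hi => ?_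
  have hi : i ≤ k := Finset.mem_range_succ_iff.1 hi
  have hμi := choose_mul_monoNormSq (ν := μ) (Nat.sub_le k i)
  rw [Nat.choose_symm hi, Nat.sub_sub_self hi] at hμi
  have hνi := choose_mul_monoNormSq (ν := ν) hi
  push_cast
  linear_combination (k.choose i : ℝ) * monoNormSq ν (k - i) * hμi +
    (μ + k - 1).choose (k - i) * monoNormSq μ k * hνi

lemma normConst_sq_mul_lowestNormSq [μ.AtLeastTwo] [ν.AtLeastTwo] (k : ℕ) :
    normConst μ ν k ^ 2 * lowestNormSq μ ν k = 1 := by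
  have hμ : 2 ≤ μ := Nat.AtLeastTwo.prop
  have hν : 2 ≤ ν := Nat.AtLeastTwo.prop
  have : (μ + ν + k - 1).AtLeastTwo := ⟨by lia⟩
  have hcast : (μ : ℝ) + ν + k - 1 = (μ + ν + k - 1 : ℕ) := by
    rw [Nat.cast_sub (by lia)]
    push_cast
    ring
  have h₁ := multichoose_cast_pos (ν := μ) k
  have h₂ := multichoose_cast_pos (ν := ν) k
  have h₃ := multichoose_cast_pos (ν := μ + ν + k - 1) k
  rw [lowestNormSq_eq, normConst, hcast, poch_natCast, poch_natCast, poch_natCast,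
    Real.sq_sqrt (by positivity), monoNormSq, monoNormSq]
  field_simp

lemma sum_choose_sq_mul_choose_mul_monoNormSq [ν.AtLeastTwo] (hj : j ≤ k) :
    ∑ i ∈ Finset.range (k + 1), (k.choose i : ℝ) ^ 2 * i.choose j * monoNormSq ν (k - i) =
      k.choose j * (poch ((ν : ℝ) + k - j) k / poch ν k) := by
  have hν : 2 ≤ ν := Nat.AtLeastTwo.prop
  have hcast : (ν : ℝ) + k - j = (ν + k - j : ℕ) := by
    rw [Nat.cast_sub (by lia)]
    push_cast
    ring
  rw [hcast, poch_natCast, poch_natCast, mul_div_mul_left _ _ (by positivity), div_eq_mul_inv,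
    ← monoNormSq, Nat.multichoose_eq, show ν + k - j + k - 1 = (ν + k - 1) + (k - j) by lia,
    ← sum_choose_mul_choose_sub, Nat.cast_sum, Finset.sum_mul, Finset.mul_sum]
  refine Finset.sum_congr rfl fun i hi => ?_
  have hi : i ≤ k := Finset.mem_range_succ_iff.1 hi
  have hνi := choose_mul_monoNormSq (ν := ν) hi
  have hij : (k.choose i : ℝ) * i.choose j = k.choose j * (k - j).choose (k - i) := by
    exact_mod_cast choose_mul_choose_eq_choose_mul_choose_sub hi
  push_cast
  linear_combination (k.choose i : ℝ) * i.choose j * hνi +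
    (ν + k - 1).choose i * monoNormSq ν k * hij

lemma sum_choose_sq_mul_sum_choose_mul [ν.AtLeastTwo] (B : ℕ → ℂ) :
    ∑ i ∈ Finset.range (k + 1), ((k.choose i : ℝ) ^ 2 * monoNormSq ν (k - i) : ℝ) *
        ∑ j ∈ Finset.range (i + 1), i.choose j * ((-1) ^ j * B j) =
      ∑ j ∈ Finset.range (k + 1), (-1 : ℂ) ^ j * (k.choose j : ℂ) *
        ((poch ((ν : ℝ) + k - j) k / poch ν k : ℝ) : ℂ) * B j := by
  calc _ = ∑ i ∈ Finset.range (k + 1), ∑ j ∈ Finset.range (k + 1),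
          ((k.choose i : ℝ) ^ 2 * i.choose j * monoNormSq ν (k - i) : ℝ) * ((-1) ^ j * B j) := by
        refine Finset.sum_congr rfl fun i hi => ?_
        rw [sum_range_choose_mul_of_le (Finset.mem_range_succ_iff.1 hi), Finset.mul_sum]
        refine Finset.sum_congr rfl fun j _ => ?_
        push_cast
        ring
    _ = ∑ j ∈ Finset.range (k + 1),
          ((k.choose j * (poch ((ν : ℝ) + k - j) k / poch ν k) : ℝ) : ℂ) * ((-1) ^ j * B j) := by
        rw [Finset.sum_comm]
        refine Finset.sum_congr rfl fun j hj => ?_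
        rw [← sum_choose_sq_mul_choose_mul_monoNormSq (Finset.mem_range_succ_iff.1 hj),
          ofReal_sum, Finset.sum_mul]
    _ = _ := Finset.sum_congr rfl fun j _ => by
        push_cast
        ring

end Binomial

/-! ### Lowest weight vectors -/

section Lowest

variable {μ ν : ℕ} [μ.AtLeastTwo] [ν.AtLeastTwo]

/-- The coefficient of `x ^ j * y ^ (k - j)` in `(x - y) ^ k`. -/
def signedChoose (k j : ℕ) : ℂ := (-1) ^ (k - j) * (k.choose j : ℂ)

lemma sum_signedChoose_mul (k : ℕ) (x y : ℂ) :
    ∑ j ∈ Finset.range (k + 1), signedChoose k j * (x ^ j * y ^ (k - j)) = (x - y) ^ k := by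
  rw [sub_eq_add_neg, add_pow]
  refine Finset.sum_congr rfl fun j _ => ?_
  rw [signedChoose, neg_pow y]
  ring

lemma conj_signedChoose_mul_self (k j : ℕ) :
    conj (signedChoose k j) * signedChoose k j = (k.choose j : ℂ) ^ 2 := by
  simp only [signedChoose, map_mul, map_pow, map_neg, map_one, map_natCast]
  rw [mul_mul_mul_comm, ← mul_pow, neg_one_mul, neg_neg, one_pow, one_mul, sq]

variable (μ ν) in
/-- The function `(x - y)^k (1 - x * conj z)^(-μ-k) (1 - y * conj z)^(-ν-k)` of `(x, y)`, as an
element of the Hilbert space tensor product: the unnormalized image of the kernel at `z` under the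
adjoint of a component projection. -/
def lowest (k : ℕ) (z : Disc) : HTensor μ ν :=
  ∑ j ∈ Finset.range (k + 1), signedChoose k j •
    tmul (powKernel μ j (μ + k) z) (powKernel ν (k - j) (ν + k) z)

lemma lowest_origin (k : ℕ) :
    lowest μ ν k origin =
      ∑ j ∈ Finset.range (k + 1), signedChoose k j • tmul (mono μ j) (mono ν (k - j)) := by
  simp only [lowest, powKernel_origin]

lemma inner_kernel_lowest (k : ℕ) (x y z : Disc) :
    inner ℂ (tmul (kernel μ x) (kernel ν y)) (lowest μ ν k z) =
      ((x : ℂ) - y) ^ k * ((1 - (x : ℂ) * conj (z : ℂ)) ^ (μ + k))⁻¹ *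
        ((1 - (y : ℂ) * conj (z : ℂ)) ^ (ν + k))⁻¹ := by
  rw [lowest, inner_sum, ← sum_signedChoose_mul, Finset.sum_mul, Finset.sum_mul]
  refine Finset.sum_congr rfl fun j _ => ?_
  rw [inner_smul_right, inner_tmul, inner_kernel, inner_kernel, fn_powKernel, fn_powKernel]
  ring

lemma moebius_sub_moebius (g : SU) (x y : Disc) :
    (moebius g x : ℂ) - moebius g y = ((x : ℂ) - y) / ((g.a + g.b * x) * (g.a + g.b * y)) := by
  rw [coe_moebius, coe_moebius, div_sub_div _ _ (g.denom_ne_zero x) (g.denom_ne_zero y)]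
  congr 1
  linear_combination ((x : ℂ) - y) * g.mul_conj_sub_mul_conj

lemma one_sub_moebius_inv_mul (g : SU) (x z : Disc) :
    1 - (moebius g⁻¹ x : ℂ) * conj (z : ℂ) =
      conj (g.a + g.b * (z : ℂ)) * (1 - (x : ℂ) * conj (moebius g z : ℂ)) /
        (g⁻¹.a + g⁻¹.b * x) := by
  have h := denom_mul_one_sub_moebius g (moebius g⁻¹ x) z
  have hx := denom_inv_moebius_mul g⁻¹ x
  have hmx := moebius_inv_moebius g⁻¹ x
  rw [inv_inv] at hx hmx
  rw [hmx] at h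
  rw [← h, eq_div_iff (g⁻¹.denom_ne_zero x)]
  linear_combination
    conj (g.a + g.b * (z : ℂ)) * (1 - (x : ℂ) * conj (moebius g z : ℂ)) * hx

lemma tensorAction_lowest (k : ℕ) (g : SU) (z : Disc) :
    tensorAction μ ν g (lowest μ ν k z) =
      (conj (g.a + g.b * (z : ℂ)) ^ (μ + ν + 2 * k))⁻¹ • lowest μ ν k (moebius g z) := by
  refine eq_of_inner_kernel_tmul fun x y => ?_
  rw [inner_tensorAction_right, tensorAction_tmul, action_kernel, action_kernel, tmul_smul_smul,
    inner_smul_left, inner_smul_right, inner_kernel_lowest, inner_kernel_lowest,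
    moebius_sub_moebius, one_sub_moebius_inv_mul, one_sub_moebius_inv_mul]
  have hx := g⁻¹.denom_ne_zero x
  have hy := g⁻¹.denom_ne_zero y
  have hz : conj (g.a + g.b * (z : ℂ)) ≠ 0 := (map_ne_zero _).2 (g.denom_ne_zero z)
  have hxz := one_sub_mul_conj_ne_zero x (moebius g z)
  have hyz := one_sub_mul_conj_ne_zero y (moebius g z)
  simp only [map_mul _ (_⁻¹) (_⁻¹), map_inv₀, map_pow, conj_conj, div_pow, mul_pow]
  field_simp
  ring

lemma inner_mono_powKernel_of_lt {i j : ℕ} (h : i < j) (m : ℕ) (z : Disc) :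
    inner ℂ (mono ν i) (powKernel ν j m z) = 0 := by
  rw [← inner_conj_symm, (hasSum_inner_powKernel j m z (mono ν i)).unique
    (hasSum_zero.congr_fun fun n => ?_), map_zero]
  rw [inner_mono_mono, if_neg (by lia), mul_zero]

lemma inner_mono_powKernel_self (i m : ℕ) (z : Disc) :
    inner ℂ (mono ν i) (powKernel ν i m z) = monoNormSq ν i := by
  rw [← inner_conj_symm, (hasSum_inner_powKernel i m z (mono ν i)).unique
    (hasSum_single 0 fun n hn => ?_)]
  · rw [add_zero, inner_mono_mono, if_pos rfl, Nat.multichoose_zero_right, Nat.cast_one, pow_zero,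
      one_mul, one_mul, conj_ofReal]
  · rw [inner_mono_mono, if_neg (by lia), mul_zero]

lemma inner_lowest_origin_lowest (k : ℕ) (z : Disc) :
    inner ℂ (lowest μ ν k origin) (lowest μ ν k z) = lowestNormSq μ ν k := by
  have horth {i j : ℕ} (hi : i ≤ k) (hij : i ≠ j) :
      inner ℂ (tmul (mono μ i) (mono ν (k - i)))
        (tmul (powKernel μ j (μ + k) z) (powKernel ν (k - j) (ν + k) z)) = 0 := by
    rw [inner_tmul]
    rcases hij.lt_or_gt with hlt | hlt
    · rw [inner_mono_powKernel_of_lt hlt, zero_mul]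
    · rw [inner_mono_powKernel_of_lt (show k - i < k - j by lia), mul_zero]
  rw [lowest_origin, lowest, sum_inner, lowestNormSq, ofReal_sum]
  refine Finset.sum_congr rfl fun i hi => ?_
  rw [inner_sum, Finset.sum_eq_single_of_mem i hi fun j _ hji => ?_]
  · rw [inner_smul_left, inner_smul_right, inner_tmul, inner_mono_powKernel_self,
      inner_mono_powKernel_self, ← mul_assoc, conj_signedChoose_mul_self]
    push_cast
    ring
  · rw [inner_smul_left, inner_smul_right, horth (Finset.mem_range_succ_iff.1 hi) hji.symm,
      mul_zero, mul_zero]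

/-- The element of `SU(1,1)` with positive diagonal that maps the origin to `z`. -/
def translation (z : Disc) : SU where
  a := ((Real.sqrt (1 - ‖(z : ℂ)‖ ^ 2))⁻¹ : ℝ)
  b := ((Real.sqrt (1 - ‖(z : ℂ)‖ ^ 2))⁻¹ : ℝ) * conj (z : ℂ)
  norm_sq_sub_norm_sq := by
    have hz := one_sub_norm_sq_pos z.2
    rw [norm_mul, RCLike.norm_conj, norm_real, norm_inv, Real.norm_of_nonneg (Real.sqrt_nonneg _),
      mul_pow, inv_pow, Real.sq_sqrt hz.le]
    field_simp

lemma translation_a_ne_zero (z : Disc) : (translation z).a ≠ 0 :=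
  ofReal_ne_zero.2 (inv_ne_zero (Real.sqrt_ne_zero'.2 (one_sub_norm_sq_pos z.2)))

lemma conj_translation_a (z : Disc) : conj (translation z).a = (translation z).a :=
  conj_ofReal _

lemma translation_b (z : Disc) : (translation z).b = (translation z).a * conj (z : ℂ) := rfl

lemma translation_a_sq_mul (z : Disc) : (translation z).a ^ 2 * (1 - (‖(z : ℂ)‖ : ℂ) ^ 2) = 1 := by
  have h := (translation z).mul_conj_sub_mul_conj
  rw [translation_b, map_mul, conj_conj, conj_translation_a] at h
  rw [← conj_mul']
  linear_combination h

lemma moebius_translation_origin (z : Disc) : moebius (translation z) origin = z := by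
  refine Subtype.ext ?_
  have h := translation_a_ne_zero z
  rw [coe_moebius, translation_b, map_mul, conj_conj, conj_translation_a, coe_origin, mul_zero,
    mul_zero, zero_add, add_zero, mul_div_cancel_left₀ _ h]

lemma kernel_eq_action_translation (z : Disc) :
    kernel ν z = (translation z).a ^ ν • action ν (translation z) (mono ν 0) := by
  rw [← kernel_origin, action_kernel, moebius_translation_origin, coe_origin, mul_zero, add_zero,
    conj_translation_a, smul_inv_smul₀ (pow_ne_zero _ (translation_a_ne_zero z))]

lemma lowest_eq_tensorAction_translation (k : ℕ) (z : Disc) :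
    lowest μ ν k z = (translation z).a ^ (μ + ν + 2 * k) •
      tensorAction μ ν (translation z) (lowest μ ν k origin) := by
  rw [tensorAction_lowest, moebius_translation_origin, coe_origin, mul_zero, add_zero,
    conj_translation_a, smul_inv_smul₀ (pow_ne_zero _ (translation_a_ne_zero z))]

lemma inner_lowest_lowest (k : ℕ) (z w : Disc) :
    inner ℂ (lowest μ ν k z) (lowest μ ν k w) =
      lowestNormSq μ ν k * ((1 - (z : ℂ) * conj (w : ℂ)) ^ (μ + ν + 2 * k))⁻¹ := by
  set g := translation z
  have hg : g.a ≠ 0 := translation_a_ne_zero z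
  have hdenom : conj (g⁻¹.a + g⁻¹.b * (w : ℂ)) = g.a * (1 - (z : ℂ) * conj (w : ℂ)) := by
    simp only [SU.inv_a, SU.inv_b, g, translation_b, map_add, map_neg, map_mul, conj_conj,
      conj_translation_a]
    ring
  rw [lowest_eq_tensorAction_translation, inner_smul_left, ← inv_inv (translation z),
    ← inner_tensorAction_right, tensorAction_lowest, inner_smul_right, inner_lowest_origin_lowest,
    hdenom, inv_inv, map_pow, conj_translation_a, mul_pow, mul_inv, ← mul_assoc, ← mul_assoc,
    mul_inv_cancel₀ (pow_ne_zero _ hg), one_mul, mul_comm]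

end Lowest

/-! ### Existence of the component projections -/

instance atLeastTwo_add (m n : ℕ) [m.AtLeastTwo] : (m + n).AtLeastTwo :=
  ⟨le_add_right Nat.AtLeastTwo.prop⟩

section Existence

variable {μ ν k : ℕ} [μ.AtLeastTwo] [ν.AtLeastTwo]

lemma isComponentProjection_iff {P : HTensor μ ν →L[ℂ] H (μ + ν + 2 * k)} :
    IsComponentProjection μ ν k P ↔
      P ∘L ContinuousLinearMap.adjoint P = ContinuousLinearMap.id ℂ _ ∧
        ∀ g t, P (tensorAction μ ν g t) = action (μ + ν + 2 * k) g (P t) := by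
  refine ⟨fun hP => ⟨hP.comp_adjoint, fun g => DFunLike.congr_fun (f := P ∘L tensorAction μ ν g)
    (g := (action _ g).toContinuousLinearMap ∘L P) (ext_tmul fun u v => H_ext fun z => ?_)⟩,
    fun hP => ⟨hP.1, fun a b hab u u' v v' hu hv z hz => ?_⟩⟩
  · rw [ContinuousLinearMap.comp_apply, ContinuousLinearMap.comp_apply, tensorAction_tmul,
      LinearIsometry.coe_toContinuousLinearMap, fn_action]
    exact hP.intertwines g.a g.b g.norm_sq_sub_norm_sq u _ v _
      (fun x hx => fn_action g u ⟨x, hx⟩) (fun x hx => fn_action g v ⟨x, hx⟩) z z.2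
  · have hu' : u' = action μ ⟨a, b, hab⟩ u :=
      H_ext fun x => by rw [hu x x.2, fn_action]
    have hv' : v' = action ν ⟨a, b, hab⟩ v :=
      H_ext fun x => by rw [hv x x.2, fn_action]
    rw [hu', hv', ← tensorAction_tmul, hP.2]
    exact fn_action _ _ ⟨z, hz⟩

variable (μ ν k) in
lemma exists_linearIsometry_lowest :
    ∃ V : H (μ + ν + 2 * k) →ₗᵢ[ℂ] HTensor μ ν,
      ∀ z, V (kernel _ z) = (normConst μ ν k : ℂ) • lowest μ ν k z := by
  refine exists_linearIsometry_of_gram (dense_span_kernel _) fun z w => ?_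
  have hC : (normConst μ ν k : ℂ) ^ 2 * lowestNormSq μ ν k = 1 := by
    exact_mod_cast normConst_sq_mul_lowestNormSq k
  rw [inner_kernel_kernel, inner_smul_left, inner_smul_right, inner_lowest_lowest, conj_ofReal]
  linear_combination (-((1 - (z : ℂ) * conj (w : ℂ)) ^ (μ + ν + 2 * k))⁻¹) * hC

lemma isComponentProjection_adjoint {V : H (μ + ν + 2 * k) →ₗᵢ[ℂ] HTensor μ ν} {c : ℂ}
    (hV : ∀ z, V (kernel _ z) = c • lowest μ ν k z) :
    IsComponentProjection μ ν k (ContinuousLinearMap.adjoint V.toContinuousLinearMap) := by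
  have hequiv (g : SU) : V.toContinuousLinearMap ∘L (action _ g).toContinuousLinearMap =
      tensorAction μ ν g ∘L V.toContinuousLinearMap := by
    refine ContinuousLinearMap.ext_on (dense_span_kernel _) (Set.forall_mem_range.2 fun z => ?_)
    simp only [ContinuousLinearMap.comp_apply, LinearIsometry.coe_toContinuousLinearMap,
      action_kernel, map_smul, hV, tensorAction_lowest]
    rw [smul_comm]
  refine isComponentProjection_iff.2 ⟨?_, fun g t => ext_inner_left ℂ fun u => ?_⟩
  · rw [ContinuousLinearMap.adjoint_adjoint]
    refine ContinuousLinearMap.ext fun u => ext_inner_left ℂ fun v => ?_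
    rw [ContinuousLinearMap.comp_apply, ContinuousLinearMap.adjoint_inner_right]
    exact V.inner_map_map v u
  · rw [ContinuousLinearMap.adjoint_inner_right, inner_action_right,
      ContinuousLinearMap.adjoint_inner_right, inner_tensorAction_right]
    exact congrArg (inner ℂ · t) (DFunLike.congr_fun (hequiv g⁻¹) u).symm

variable (μ ν k) in
lemma exists_isComponentProjection :
    ∃ P : HTensor μ ν →L[ℂ] H (μ + ν + 2 * k), IsComponentProjection μ ν k P :=
  let ⟨_, hV⟩ := exists_linearIsometry_lowest μ ν k
  ⟨_, isComponentProjection_adjoint hV⟩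

end Existence

/-! ### Uniqueness of the component projections -/

section Translate

variable {ν : ℕ} [ν.AtLeastTwo]

lemma fn_action_translation_mono (z : Disc) (i : ℕ) (x : Disc) :
    fn (action ν (translation z) (mono ν i)) x =
      (((translation z).a * (1 - (x : ℂ) * conj (z : ℂ))) ^ ν)⁻¹ *
        (((x : ℂ) - z) / (1 - x * conj (z : ℂ))) ^ i := by
  have ha := translation_a_ne_zero z
  have hdenom : (translation z)⁻¹.a + (translation z)⁻¹.b * x =
      (translation z).a * (1 - (x : ℂ) * conj (z : ℂ)) := by
    rw [SU.inv_a, SU.inv_b, conj_translation_a, translation_b]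
    ring
  have hnum : conj (translation z)⁻¹.a * (x : ℂ) + conj (translation z)⁻¹.b =
      (translation z).a * ((x : ℂ) - z) := by
    rw [SU.inv_a, SU.inv_b, conj_conj, map_neg, translation_b, map_mul, conj_conj,
      conj_translation_a]
    ring
  rw [← inner_kernel, inner_action_right, action_kernel, inner_smul_left, inner_kernel, fn_mono,
    coe_moebius, hdenom, hnum, mul_div_mul_left _ _ ha, map_inv₀, map_pow, conj_conj]

lemma powKernel_eq_sum_action_translation (i : ℕ) (z : Disc) :
    powKernel ν i (ν + i) z = (translation z).a ^ (ν + 2 * i) •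
      ∑ l ∈ Finset.range (i + 1),
        (i.choose l * (z : ℂ) ^ (i - l)) • action ν (translation z) (mono ν l) := by
  refine H_ext fun x => ?_
  have ha := translation_a_ne_zero z
  have hasq := translation_a_sq_mul z
  have hx := one_sub_mul_conj_ne_zero x z
  set q := 1 - (x : ℂ) * conj (z : ℂ) with hq
  set a := (translation z).a
  have hpow : (x : ℂ) / q = a ^ 2 * (((x : ℂ) - z) / q + z) := by
    rw [← conj_mul'] at hasq
    field_simp
    linear_combination (-(x : ℂ)) * hasq + a ^ 2 * z * hq
  rw [← inner_kernel _ (_ • _), inner_smul_right, inner_sum]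
  simp only [inner_smul_right, inner_kernel, fn_action_translation_mono]
  calc fn (powKernel ν i (ν + i) z) x = (q ^ ν)⁻¹ * ((x : ℂ) / q) ^ i := by
        rw [fn_powKernel, div_pow, pow_add, mul_inv]
        ring
    _ = a ^ (ν + 2 * i) * (((a * q) ^ ν)⁻¹ * (((x : ℂ) - z) / q + z) ^ i) := by
        rw [hpow, mul_pow, mul_pow, pow_add, pow_mul]
        field_simp
    _ = _ := by
        rw [add_pow, Finset.mul_sum]
        exact congrArg _ (Finset.sum_congr rfl fun l _ => by ring)

lemma inner_powKernel_mono (i p : ℕ) (z : Disc) :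
    inner ℂ (powKernel ν i (ν + i) z) (mono ν p) =
      monoNormSq ν i * (p.choose i * (z : ℂ) ^ (p - i)) := by
  have hsum := hasSum_inner_powKernel i (ν + i) z (mono ν p)
  rcases le_or_gt i p with hip | hpi
  · obtain ⟨n, rfl⟩ := Nat.exists_eq_add_of_le hip
    have hcoeff : ((ν + i).multichoose n : ℂ) * monoNormSq ν (i + n) =
        (i + n).choose i * monoNormSq ν i := by
      exact_mod_cast multichoose_add_mul_monoNormSq i n
    rw [hsum.unique (hasSum_single n fun m hm => ?_), inner_mono_mono, if_pos rfl,
      Nat.add_sub_cancel_left]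
    · linear_combination (z : ℂ) ^ n * hcoeff
    · rw [inner_mono_mono, if_neg (by lia), mul_zero]
  · rw [hsum.unique (hasSum_zero.congr_fun fun n => ?_), Nat.choose_eq_zero_of_lt hpi,
      Nat.cast_zero, zero_mul, mul_zero]
    rw [inner_mono_mono, if_neg (by lia), mul_zero]

end Translate

section Rotation

variable {ν : ℕ} [ν.AtLeastTwo]

/-- The diagonal element of `SU(1,1)` with entries `c` and `conj c`. -/
def diagonal (c : ℂ) (hc : ‖c‖ = 1) : SU where
  a := c
  b := 0
  norm_sq_sub_norm_sq := by rw [hc, norm_zero, one_pow, sq, mul_zero, sub_zero]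

lemma action_diagonal_mono {c : ℂ} (hc : ‖c‖ = 1) (n : ℕ) :
    action ν (diagonal c hc) (mono ν n) = c ^ (ν + 2 * n) • mono ν n := by
  have : c ≠ 0 := norm_ne_zero_iff.1 (hc.trans_ne one_ne_zero)
  have hconj : conj c = c⁻¹ := (inv_eq_conj hc).symm
  refine H_ext fun z => ?_
  rw [← inner_kernel, ← inner_kernel, inner_action_right, action_kernel, inner_smul_left,
    inner_smul_right, inner_kernel, inner_kernel, fn_mono, fn_mono, coe_moebius, SU.inv_a, SU.inv_b,
    diagonal, conj_conj, neg_zero, map_zero, zero_mul, add_zero, add_zero]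
  simp only [map_inv₀, map_pow, hconj, inv_inv, inv_pow]
  field_simp
  ring

lemma exists_norm_eq_one_pow_ne_pow {m n : ℕ} (h : m ≠ n) : ∃ c : ℂ, ‖c‖ = 1 ∧ c ^ m ≠ c ^ n := by
  have hc := isPrimitiveRoot_exp (m + n + 1) (Nat.succ_ne_zero _)
  exact ⟨_, hc.norm'_eq_one (Nat.succ_ne_zero _),
    fun heq => h (hc.pow_inj (by lia) (by lia) heq)⟩

end Rotation

namespace IsComponentProjection

variable {μ ν k : ℕ} [μ.AtLeastTwo] [ν.AtLeastTwo] {P : HTensor μ ν →L[ℂ] H (μ + ν + 2 * k)}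
  (hP : IsComponentProjection μ ν k P)

include hP

lemma apply_tensorAction (g : SU) (t : HTensor μ ν) :
    P (tensorAction μ ν g t) = action (μ + ν + 2 * k) g (P t) :=
  (isComponentProjection_iff.1 hP).2 g t

lemma adjoint_action (g : SU) (u : H (μ + ν + 2 * k)) :
    ContinuousLinearMap.adjoint P (action _ g u) =
      tensorAction μ ν g (ContinuousLinearMap.adjoint P u) := by
  refine ext_inner_left ℂ fun t => ?_
  rw [ContinuousLinearMap.adjoint_inner_right, inner_action_right, inner_tensorAction_right,
    ContinuousLinearMap.adjoint_inner_right, hP.apply_tensorAction]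

lemma inner_mono_apply_tmul_mono {i j n : ℕ} (hne : i + j ≠ k + n) :
    inner ℂ (mono (μ + ν + 2 * k) n) (P (tmul (mono μ i) (mono ν j))) = 0 := by
  obtain ⟨c, hc, hpow⟩ := exists_norm_eq_one_pow_ne_pow
    (show μ + 2 * i + (ν + 2 * j) ≠ μ + ν + 2 * k + 2 * n by lia)
  have hc0 : c ≠ 0 := norm_ne_zero_iff.1 (hc.trans_ne one_ne_zero)
  have h := (action _ (diagonal c hc)).inner_map_map (mono (μ + ν + 2 * k) n)
    (P (tmul (mono μ i) (mono ν j)))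
  rw [← hP.apply_tensorAction, tensorAction_tmul, action_diagonal_mono, action_diagonal_mono,
    action_diagonal_mono, tmul_smul_smul, map_smul, inner_smul_left, inner_smul_right, ← pow_add,
    map_pow, ← inv_eq_conj hc, inv_pow, inv_mul_eq_iff_eq_mul₀ (pow_ne_zero _ hc0)] at h
  exact (mul_eq_mul_right_iff.1 h).resolve_left hpow

lemma apply_tmul_mono_eq_zero {i j : ℕ} (h : i + j < k) : P (tmul (mono μ i) (mono ν j)) = 0 :=
  eq_zero_of_inner_mono fun _ => hP.inner_mono_apply_tmul_mono (by lia)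

lemma apply_tmul_powKernel_kernel {i : ℕ} (hi : i < k) (z : Disc) :
    P (tmul (powKernel μ i (μ + i) z) (kernel ν z)) = 0 := by
  rw [powKernel_eq_sum_action_translation, kernel_eq_action_translation, tmul_smul_smul,
    ← tmulL_apply, map_sum, _root_.sum_apply, map_smul, map_sum,
    Finset.sum_eq_zero, smul_zero]
  intro l hl
  have hl : l ≤ i := Finset.mem_range_succ_iff.1 hl
  rw [map_smul, _root_.smul_apply, map_smul, tmulL_apply, ← tensorAction_tmul,
    hP.apply_tensorAction, hP.apply_tmul_mono_eq_zero (by lia), map_zero, smul_zero]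

lemma exists_adjoint_mono_zero_eq_sum :
    ∃ c : ℕ → ℂ, ContinuousLinearMap.adjoint P (mono (μ + ν + 2 * k) 0) =
      ∑ p ∈ Finset.range (k + 1), c p • tmul (mono μ p) (mono ν (k - p)) := by
  set Ω := ContinuousLinearMap.adjoint P (mono (μ + ν + 2 * k) 0) with hΩ
  refine ⟨fun p => inner ℂ (tmul (mono μ p) (mono ν (k - p))) Ω /
    (monoNormSq μ p * monoNormSq ν (k - p)), eq_of_inner_mono_tmul fun i j => ?_⟩
  rw [inner_sum]
  simp only [inner_smul_right, inner_tmul, inner_mono_mono]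
  by_cases hij : i + j = k
  · obtain rfl : j = k - i := by lia
    have hi : (monoNormSq μ i : ℂ) ≠ 0 := ofReal_ne_zero.2 (monoNormSq_pos i).ne'
    have hj : (monoNormSq ν (k - i) : ℂ) ≠ 0 := ofReal_ne_zero.2 (monoNormSq_pos (k - i)).ne'
    rw [Finset.sum_eq_single_of_mem i (Finset.mem_range.2 (by lia)) fun p _ hp => ?_, if_pos rfl,
      if_pos rfl, div_mul_cancel₀ _ (mul_ne_zero hi hj)]
    rw [if_neg hp.symm, zero_mul, mul_zero]
  · rw [Finset.sum_eq_zero fun p hp => ?_, hΩ, ContinuousLinearMap.adjoint_inner_right,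
      ← inner_conj_symm, hP.inner_mono_apply_tmul_mono (by lia), map_zero]
    have hp := Finset.mem_range_succ_iff.1 hp
    split_ifs
    · lia
    all_goals simp only [mul_zero, zero_mul]

lemma sum_mul_choose_eq_zero {c : ℕ → ℂ}
    (hc : ContinuousLinearMap.adjoint P (mono (μ + ν + 2 * k) 0) =
      ∑ p ∈ Finset.range (k + 1), c p • tmul (mono μ p) (mono ν (k - p)))
    {i : ℕ} (hi : i < k) : ∑ p ∈ Finset.range (k + 1), c p * p.choose i = 0 := by
  obtain ⟨z, hz⟩ : ∃ z : Disc, (z : ℂ) ≠ 0 :=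
    ⟨⟨1 / 2, by rw [mem_ball_zero_iff]; norm_num⟩, by norm_num⟩
  have h : inner ℂ (tmul (powKernel μ i (μ + i) z) (kernel ν z))
      (ContinuousLinearMap.adjoint P (mono (μ + ν + 2 * k) 0)) = 0 := by
    rw [ContinuousLinearMap.adjoint_inner_right, hP.apply_tmul_powKernel_kernel hi, inner_zero_left]
  have hterm : ∀ p ∈ Finset.range (k + 1), c p * (monoNormSq μ i *
      (p.choose i * (z : ℂ) ^ (p - i)) * (z : ℂ) ^ (k - p)) =
      c p * p.choose i * (monoNormSq μ i * (z : ℂ) ^ (k - i)) := by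
    intro p hp
    have hp := Finset.mem_range_succ_iff.1 hp
    rcases lt_or_ge p i with hpi | hip
    · rw [Nat.choose_eq_zero_of_lt hpi]
      ring
    · rw [show k - i = (p - i) + (k - p) by lia, pow_add]
      ring
  rw [hc, inner_sum] at h
  simp only [inner_smul_right, inner_tmul, inner_powKernel_mono, inner_kernel, fn_mono] at h
  rw [Finset.sum_congr rfl hterm, ← Finset.sum_mul] at h
  exact (mul_eq_zero.1 h).resolve_right
    (mul_ne_zero (ofReal_ne_zero.2 (monoNormSq_pos i).ne') (pow_ne_zero _ hz))

lemma exists_adjoint_mono_zero_eq_smul_lowest :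
    ∃ e : ℂ, ContinuousLinearMap.adjoint P (mono (μ + ν + 2 * k) 0) = e • lowest μ ν k origin := by
  obtain ⟨c, hc⟩ := hP.exists_adjoint_mono_zero_eq_sum
  refine ⟨c k, eq_of_inner_kernel_tmul fun x y => ?_⟩
  rw [hc, inner_sum, inner_smul_right, inner_kernel_lowest, coe_origin, map_zero, mul_zero,
    mul_zero, sub_zero, one_pow, one_pow, inv_one, mul_one, mul_one,
    ← sum_mul_pow_mul_pow_of_sum_mul_choose_eq_zero fun i hi => hP.sum_mul_choose_eq_zero hc hi]
  simp only [inner_smul_right, inner_tmul, inner_kernel, fn_mono]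

lemma conj_mul_self_eq_normConst_sq {e : ℂ}
    (he : ContinuousLinearMap.adjoint P (mono (μ + ν + 2 * k) 0) = e • lowest μ ν k origin) :
    conj e * e = (normConst μ ν k : ℂ) ^ 2 := by
  have hnorm : inner ℂ (mono (μ + ν + 2 * k) 0)
      (P (ContinuousLinearMap.adjoint P (mono (μ + ν + 2 * k) 0))) = 1 := by
    rw [← ContinuousLinearMap.comp_apply, hP.comp_adjoint, ContinuousLinearMap.id_apply,
      inner_mono_mono, if_pos rfl, monoNormSq, Nat.multichoose_zero_right, Nat.cast_one, inv_one,
      ofReal_one]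
  rw [← ContinuousLinearMap.adjoint_inner_left, he, inner_smul_left, inner_smul_right,
    inner_lowest_origin_lowest] at hnorm
  have hC : (normConst μ ν k : ℂ) ^ 2 * lowestNormSq μ ν k = 1 := by
    exact_mod_cast normConst_sq_mul_lowestNormSq k
  linear_combination (normConst μ ν k : ℂ) ^ 2 * hnorm - conj e * e * hC

end IsComponentProjection

/-! ### Toeplitz operators and the Berezin transform -/

section Toeplitz

lemma toeplitz_integrand_ae_eq {ν : ℕ} (f : ℂ → ℂ) (u v : H ν) :
    (fun x => conj (conj (f x * toLp ν v x) * toLp ν u x)) =ᵐ[iotaW ν]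
      fun x => f x * (conj (fn u x) * fn v x) := by
  filter_upwards [toLp_ae_eq_fn u, toLp_ae_eq_fn v] with x hu hv
  rw [hu, hv, map_mul, conj_conj]
  ring

lemma integrable_toeplitz {ν : ℕ} {p : ℝ≥0∞} [Fact (1 ≤ p)] (f : Lp ℂ p iota) (u v : H ν) :
    Integrable (fun x => f x * (conj (fn u x) * fn v x)) (iotaW ν) := by
  refine (integrable_congr (toeplitz_integrand_ae_eq f u v)).1 ?_
  exact (conjCLE : ℂ →L[ℝ] ℂ).integrable_comp ((exists_bound ν f).choose_spec v u).1

variable {ν : ℕ} [ν.AtLeastTwo]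

lemma covariantSymbol_eq_inner (A : H ν →L[ℂ] H ν) (z : Disc) :
    covariantSymbol ν A z =
      inner ℂ (action ν (translation z) (mono ν 0)) (A (action ν (translation z) (mono ν 0))) := by
  have hnorm : (translation z).a ^ ν * (translation z).a ^ ν *
      (1 - (‖(z : ℂ)‖ : ℂ) ^ 2) ^ ν = 1 := by
    rw [← mul_pow, ← mul_pow, ← sq, translation_a_sq_mul, one_pow]
  rw [covariantSymbol, ← inner_kernel, kernel_eq_action_translation, map_smul, inner_smul_left,
    inner_smul_right, map_pow, conj_translation_a]
  linear_combination (inner ℂ (action ν (translation z) (mono ν 0))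
    (A (action ν (translation z) (mono ν 0)))) * hnorm

/-- The `SU(1,1)`-invariant function of two points of the disc whose `ν`-th power is the squared
modulus of the inner product of the normalized reproducing kernels of weight `ν` at these points. -/
def invariant (z x : ℂ) : ℝ :=
  (1 - ‖z‖ ^ 2) * (1 - ‖x‖ ^ 2) / ‖1 - x * conj z‖ ^ 2

lemma one_sub_invariant (z x : Disc) :
    1 - invariant z x = ‖((x : ℂ) - z) / (1 - x * conj (z : ℂ))‖ ^ 2 := by
  have hq := norm_ne_zero_iff.2 (one_sub_mul_conj_ne_zero x z)
  rw [invariant, norm_div, div_pow, one_sub_div (pow_ne_zero 2 hq)]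
  congr 1
  apply ofReal_injective
  push_cast
  rw [← conj_mul', ← conj_mul', ← conj_mul', ← conj_mul']
  simp only [map_sub, map_mul, map_one, conj_conj]
  ring

lemma norm_translation_a_sq_mul (z : Disc) : ‖(translation z).a‖ ^ 2 * (1 - ‖(z : ℂ)‖ ^ 2) = 1 := by
  have h := (translation z).norm_sq_sub_norm_sq
  rw [translation_b, norm_mul, norm_conj] at h
  linarith

lemma norm_fn_action_translation_mono_sq (z : Disc) (i : ℕ) (x : Disc) :
    (1 - ‖(x : ℂ)‖ ^ 2) ^ ν * ‖fn (action ν (translation z) (mono ν i)) x‖ ^ 2 =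
      invariant z x ^ ν * (1 - invariant z x) ^ i := by
  have ha : ‖(translation z).a‖ ≠ 0 := norm_ne_zero_iff.2 (translation_a_ne_zero z)
  have hq := norm_ne_zero_iff.2 (one_sub_mul_conj_ne_zero x z)
  have hz : 1 - ‖(z : ℂ)‖ ^ 2 = (‖(translation z).a‖ ^ 2)⁻¹ :=
    (inv_eq_of_mul_eq_one_right (norm_translation_a_sq_mul z)).symm
  rw [fn_action_translation_mono, one_sub_invariant, invariant, hz, norm_mul, norm_inv, norm_pow,
    norm_pow, norm_mul]
  simp only [div_pow, mul_pow, inv_pow]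
  field_simp
  ring

lemma toeplitz_translation_integrand_ae_eq (f : ℂ → ℂ) (z : Disc) (i : ℕ) :
    (fun x : ℂ => (1 - (‖x‖ : ℂ) ^ 2) ^ ν * (f x *
      (conj (fn (action ν (translation z) (mono ν i)) x) *
        fn (action ν (translation z) (mono ν i)) x))) =ᵐ[iota]
      fun x => f x * (invariant z x ^ ν * (1 - invariant z x) ^ i : ℝ) := by
  filter_upwards [ae_iota_mem] with x hx
  rw [← norm_fn_action_translation_mono_sq z i ⟨x, hx⟩, conj_mul']
  push_cast
  ring

variable {p : ℝ≥0∞} [Fact (1 ≤ p)] (f : Lp ℂ p iota)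

lemma inner_Rstar (u v : H ν) :
    inner ℂ u (Rstar ν f v) =
      ∫ x, (1 - (‖x‖ : ℂ) ^ 2) ^ ν * (f x * (conj (fn u x) * fn v x)) ∂iota := by
  have hν : (ν : ℂ) - 1 ≠ 0 := by exact_mod_cast sub_ne_zero.2 (one_lt_cast (ν := ν)).ne'
  rw [Rstar, _root_.smul_apply, inner_smul_right, ← inner_conj_symm, inner_toeplitz,
    ← integral_conj, integral_congr_ae (toeplitz_integrand_ae_eq f u v),
    integral_iotaW_eq_integral_iota, inv_mul_cancel_left₀ hν]

variable (ν) in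
lemma integrable_mul_invariant_pow (z : Disc) (i : ℕ) :
    Integrable (fun x => f x * (invariant z x ^ ν * (1 - invariant z x) ^ i : ℝ)) iota :=
  (integrable_congr (toeplitz_translation_integrand_ae_eq f z i)).1
    ((integrable_iotaW_iff _ _).1 (integrable_toeplitz f _ _))

lemma inner_Rstar_action_translation_mono (z : Disc) (i : ℕ) :
    inner ℂ (action ν (translation z) (mono ν i))
      (Rstar ν f (action ν (translation z) (mono ν i))) =
      ∫ x, f x * (invariant z x ^ ν * (1 - invariant z x) ^ i : ℝ) ∂iota := by
  rw [inner_Rstar, integral_congr_ae (toeplitz_translation_integrand_ae_eq f z i)]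

lemma berezin_eq_integral (z : Disc) :
    berezin ν f z = ∫ x, f x * (invariant z x ^ ν : ℝ) ∂iota := by
  rw [berezin, covariantSymbol_eq_inner, inner_Rstar_action_translation_mono]
  simp only [pow_zero, mul_one]

lemma inner_Rstar_action_translation_mono_eq_sum_berezin (z : Disc) (i : ℕ) :
    inner ℂ (action ν (translation z) (mono ν i))
      (Rstar ν f (action ν (translation z) (mono ν i))) =
      ∑ j ∈ Finset.range (i + 1), i.choose j * ((-1) ^ j * berezin (ν + j) f z) := by
  have hexpand (x : ℂ) : f x * (invariant z x ^ ν * (1 - invariant z x) ^ i : ℝ) =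
      ∑ j ∈ Finset.range (i + 1),
        i.choose j * ((-1) ^ j * (f x * (invariant z x ^ (ν + j) : ℝ))) := by
    rw [sub_eq_neg_add, add_pow, Finset.mul_sum, ofReal_sum, Finset.mul_sum]
    refine Finset.sum_congr rfl fun j _ => ?_
    rw [neg_pow (invariant z x), pow_add]
    push_cast
    ring
  have hint (j : ℕ) : Integrable (fun x => f x * (invariant z x ^ (ν + j) : ℝ)) iota := by
    simpa only [pow_zero, mul_one] using integrable_mul_invariant_pow (ν + j) f z 0
  rw [inner_Rstar_action_translation_mono, integral_congr_ae (.of_forall hexpand),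
    integral_finsetSum _ fun j _ => ((hint j).const_mul _).const_mul _]
  simp only [integral_const_mul, berezin_eq_integral]

end Toeplitz

/-! ### The covariant symbol of the channel -/

section Channel

variable {μ ν k : ℕ} [μ.AtLeastTwo] [ν.AtLeastTwo]

lemma inner_tensorAction_lowest_tensorId (g : SU) (A : H μ →L[ℂ] H μ) :
    inner ℂ (tensorAction μ ν g (lowest μ ν k origin))
        (tensorId ν A (tensorAction μ ν g (lowest μ ν k origin))) =
      ∑ i ∈ Finset.range (k + 1), ((k.choose i : ℝ) ^ 2 * monoNormSq ν (k - i) : ℝ) *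
        inner ℂ (action μ g (mono μ i)) (A (action μ g (mono μ i))) := by
  simp only [lowest_origin, map_sum, map_smul, tensorAction_tmul, tensorId_tmul, sum_inner,
    inner_sum, inner_smul_left, inner_smul_right, inner_tmul, LinearIsometry.inner_map_map,
    inner_mono_mono]
  refine Finset.sum_congr rfl fun i hi => ?_
  rw [Finset.sum_eq_single_of_mem i hi fun j hj hji => ?_, if_pos rfl]
  · push_cast
    rw [← conj_signedChoose_mul_self]
    ring
  · have hi := Finset.mem_range_succ_iff.1 hi
    have hj := Finset.mem_range_succ_iff.1 hj
    rw [if_neg (by lia), mul_zero, mul_zero]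

lemma IsComponentProjection.covariantSymbol_channel {P : HTensor μ ν →L[ℂ] H (μ + ν + 2 * k)}
    (hP : IsComponentProjection μ ν k P) (A : H μ →L[ℂ] H μ) (z : Disc) :
    covariantSymbol (μ + ν + 2 * k) (channel P A) z = (normConst μ ν k : ℂ) ^ 2 *
      ∑ i ∈ Finset.range (k + 1), ((k.choose i : ℝ) ^ 2 * monoNormSq ν (k - i) : ℝ) *
        inner ℂ (action μ (translation z) (mono μ i))
          (A (action μ (translation z) (mono μ i))) := by
  obtain ⟨e, he⟩ := hP.exists_adjoint_mono_zero_eq_smul_lowest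
  rw [covariantSymbol_eq_inner, channel, ContinuousLinearMap.comp_apply,
    ContinuousLinearMap.comp_apply, ← ContinuousLinearMap.adjoint_inner_left, hP.adjoint_action, he,
    map_smul, map_smul, inner_smul_left, inner_smul_right, ← mul_assoc,
    hP.conj_mul_self_eq_normConst_sq he, inner_tensorAction_lowest_tensorId]

end Channel

end

end SU11

theorem mainTheorem7 (μ ν k : ℕ) (hμ : 2 ≤ μ) (hν : 2 ≤ ν) :
    (∃ P : SU11.HTensor μ ν →L[ℂ] SU11.H (μ + ν + 2 * k), SU11.IsComponentProjection μ ν k P) ∧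
    ∀ P : SU11.HTensor μ ν →L[ℂ] SU11.H (μ + ν + 2 * k), SU11.IsComponentProjection μ ν k P →
      ∀ (p : ENNReal) [Fact (1 ≤ p)] (f : MeasureTheory.Lp ℂ p SU11.iota) (z : SU11.Disc),
        SU11.covariantSymbol (μ + ν + 2 * k) (SU11.channel P (SU11.Rstar μ f)) z =
          (SU11.normConst μ ν k : ℂ) ^ 2 *
            ∑ j ∈ Finset.range (k + 1),
              (-1 : ℂ) ^ j * (k.choose j : ℂ) *
                ((SU11.poch ((ν : ℝ) + k - j) k / SU11.poch ν k : ℝ) : ℂ) *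
                  SU11.berezin (μ + j) f z := by
  have : μ.AtLeastTwo := ⟨hμ⟩
  have : ν.AtLeastTwo := ⟨hν⟩
  refine ⟨SU11.exists_isComponentProjection μ ν k, fun P hP p _ f z => ?_⟩
  simp only [hP.covariantSymbol_channel, SU11.inner_Rstar_action_translation_mono_eq_sum_berezin,
    SU11.sum_choose_sq_mul_sum_choose_mul]
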